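/- Let $d\ge 2$ be a fixed integer. There is a deterministic real-RAM algorithm for touring disjoint balls in $\mathbb R^d$ with the following properties. The input consists of an integer $n\ge 0$, an accuracy $\varepsilon>0$, a starting point $p_0\in\mathbb R^d$, an ending point $p_{n+1}\in\mathbb R^d$, and $n$ closed balls $R_1,\dots,R_n\subset\mathbb R^d$, each given by its center $c_i\in\mathbb R^d$ and its radius $r_i>0$, such that the $n+2$ sets $\{p_0\},R_1,\dots,R_n,\{p_{n+1}\}$ are pairwise disjoint. For $(x_1,\dots,x_n)\in R_1\times\dots\times R_n$ write $D(x_1,\dots,x_n)=\sum_{i=0}^{n}\|x_i-x_{i+1}\|_2$, where $x_0=p_0$ and $x_{n+1}=p_{n+1}$. For every constant $\varepsilon_0\in(0,1)$ there is a constant $C$, depending only on $d$ and $\varepsilon_0$, such that on every input with $0<\varepsilon\le\varepsilon_0$ the algorithm halts after at most $$C\left(\frac{n}{\varepsilon^{d-1}}\log^2\frac1\varepsilon+\frac1{\varepsilon^{2d-2}}\right)$$ steps and outputs points $p_1'\in R_1,\dots,p_n'\in R_n$ with $$D(p_1',\dots,p_n')\le(1+\varepsilon)\min_{x\in R_1\times\dots\times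 R_n}D(x).$$ Here a real RAM is a machine with variables and arrays of natural numbers and of real numbers, arrays being addressed by computed natural numbers. Each of the following takes one step: a memory access, a constant (natural or rational), addition, subtraction and comparison of natural numbers, addition, subtraction, multiplication, division, square root and exact comparison of real numbers, a Boolean connective in a test, a test, an assignment. There is no rounding operation. -/

import Mathlib

/-! ## The touring problem -/

/-- `d`-dimensional Euclidean space. -/
abbrev Space (d : ℕ) : Type := EuclideanSpace ℝ (Fin d)

/-- The list `x₀, x₁, …, xₙ, xₙ₊₁` obtained from `x₁, …, xₙ` by adding a first and a last entry. -/
def withEnds {α : Type} {n : ℕ} (first last : α) (x : Fin n → α) : Fin (n + 2) → α :=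
  Fin.cons (α := fun _ => α) first (Fin.snoc (α := fun _ => α) x last)

/-- The length of the polygonal path `p₀, p₁, …, pₙ, pₙ₊₁` from `p₀ = start` to
`pₙ₊₁ = finish`. -/
noncomputable def tourLength {d n : ℕ} (start finish : Space d) (p : Fin n → Space d) : ℝ :=
  ∑ i : Fin (n + 1),
    dist (withEnds start finish p i.castSucc) (withEnds start finish p i.succ)

/-- `p` visits the regions in order: its `i`-th point lies in the `i`-th region. -/
def IsTour {d n : ℕ} (R : Fin n → Set (Space d)) (p : Fin n → Space d) : Prop :=
  ∀ i, p i ∈ R i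

/-- `p` is a `(1 + ε)`-approximate shortest tour of the regions `R`. -/
def IsApproxTour {d n : ℕ} (ε : ℝ) (start finish : Space d) (R : Fin n → Set (Space d))
    (p : Fin n → Space d) : Prop :=
  IsTour R p ∧
    ∀ x : Fin n → Space d, IsTour R x →
      tourLength start finish p ≤ (1 + ε) * tourLength start finish x

/-- The regions are pairwise disjoint, where the start and the end count as one-point regions. -/
def DisjointRegions {d n : ℕ} (start finish : Space d) (R : Fin n → Set (Space d)) : Prop :=
  Pairwise fun i j : Fin (n + 2) =>
    Disjoint (withEnds {start} {finish} R i) (withEnds {start} {finish} R j)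

/-! ## The real RAM

A program is a finite syntax tree. It uses variables and unbounded one-dimensional arrays, each of
which holds either natural numbers (for indices, counters and pointers) or real numbers.
Arrays are addressed by computed natural numbers. Natural numbers may be added, subtracted
and compared; real numbers may be added, subtracted, multiplied, divided and compared, and square
roots may be taken. There is no rounding and no other passage between the two sorts. Every
operation, memory access, constant, test and assignment costs one step. -/

namespace RealRAM

/-- A memory state. Variables and arrays are named by natural numbers. -/
structure Store where
  natVar : ℕ → ℕ
  realVar : ℕ → ℝ
  natArr : ℕ → ℕ → ℕ
  realArr : ℕ → ℕ → ℝ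

/-- The family of arrays `f` after `v` has been written into cell `i` of array `a`. -/
def writeCell {α : Type} (f : ℕ → ℕ → α) (a i : ℕ) (v : α) : ℕ → ℕ → α :=
  Function.update f a (Function.update (f a) i v)

/-- Expressions with natural values. Subtraction is truncated at `0`. -/
inductive NatExpr where
  | const (k : ℕ)
  | var (x : ℕ)
  | read (a : ℕ) (i : NatExpr)
  | plus (e f : NatExpr)
  | minus (e f : NatExpr)

namespace NatExpr

def eval (σ : Store) : NatExpr → ℕ
  | const k => k
  | var x => σ.natVar x
  | read a i => σ.natArr a (i.eval σ)
  | plus e f => e.eval σ + f.eval σ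
  | minus e f => e.eval σ - f.eval σ

def cost : NatExpr → ℕ
  | const _ => 1
  | var _ => 1
  | read _ i => i.cost + 1
  | plus e f => e.cost + f.cost + 1
  | minus e f => e.cost + f.cost + 1

end NatExpr

/-- Expressions with real values; the constants are rational. Division by zero and the square root
of a negative number return `0`. -/
inductive RealExpr where
  | const (q : ℚ)
  | var (x : ℕ)
  | read (a : ℕ) (i : NatExpr)
  | plus (e f : RealExpr)
  | minus (e f : RealExpr)
  | times (e f : RealExpr)
  | div (e f : RealExpr)
  | sqrt (e : RealExpr)

namespace RealExpr

noncomputable def eval (σ : Store) : RealExpr → ℝ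
  | const q => (q : ℝ)
  | var x => σ.realVar x
  | read a i => σ.realArr a (i.eval σ)
  | plus e f => e.eval σ + f.eval σ
  | minus e f => e.eval σ - f.eval σ
  | times e f => e.eval σ * f.eval σ
  | div e f => e.eval σ / f.eval σ
  | sqrt e => Real.sqrt (e.eval σ)

def cost : RealExpr → ℕ
  | const _ => 1
  | var _ => 1
  | read _ i => i.cost + 1
  | plus e f => e.cost + f.cost + 1
  | minus e f => e.cost + f.cost + 1
  | times e f => e.cost + f.cost + 1
  | div e f => e.cost + f.cost + 1
  | sqrt e => e.cost + 1

end RealExpr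

/-- Tests: exact comparisons and their Boolean combinations. -/
inductive Test where
  | natLt (e f : NatExpr)
  | realLt (e f : RealExpr)
  | neg (b : Test)
  | conj (b c : Test)

namespace Test

def eval (σ : Store) : Test → Prop
  | natLt e f => e.eval σ < f.eval σ
  | realLt e f => e.eval σ < f.eval σ
  | neg b => ¬ b.eval σ
  | conj b c => b.eval σ ∧ c.eval σ

def cost : Test → ℕ
  | natLt e f => e.cost + f.cost + 1
  | realLt e f => e.cost + f.cost + 1
  | neg b => b.cost + 1
  | conj b c => b.cost + c.cost + 1

end Test

/-- Programs. -/
inductive Prog where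
  | skip
  | setNat (x : ℕ) (e : NatExpr)
  | setReal (x : ℕ) (e : RealExpr)
  | writeNat (a : ℕ) (i e : NatExpr)
  | writeReal (a : ℕ) (i : NatExpr) (e : RealExpr)
  | seq (P Q : Prog)
  | ite (b : Test) (P Q : Prog)
  | loop (b : Test) (P : Prog)

/-- `Exec P σ t τ`: the program `P`, started in the memory state `σ`, halts after exactly `t`
steps in the memory state `τ`. The command `loop b P` repeats `P` while `b` holds. -/
inductive Exec : Prog → Store → ℕ → Store → Prop
  | skip (σ : Store) : Exec .skip σ 1 σ
  | setNat (x : ℕ) (e : NatExpr) (σ : Store) :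
      Exec (.setNat x e) σ (e.cost + 1)
        { σ with natVar := Function.update σ.natVar x (e.eval σ) }
  | setReal (x : ℕ) (e : RealExpr) (σ : Store) :
      Exec (.setReal x e) σ (e.cost + 1)
        { σ with realVar := Function.update σ.realVar x (e.eval σ) }
  | writeNat (a : ℕ) (i e : NatExpr) (σ : Store) :
      Exec (.writeNat a i e) σ (i.cost + e.cost + 1)
        { σ with natArr := writeCell σ.natArr a (i.eval σ) (e.eval σ) }
  | writeReal (a : ℕ) (i : NatExpr) (e : RealExpr) (σ : Store) :
      Exec (.writeReal a i e) σ (i.cost + e.cost + 1)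
        { σ with realArr := writeCell σ.realArr a (i.eval σ) (e.eval σ) }
  | seq {P Q : Prog} {σ τ υ : Store} {s t : ℕ} :
      Exec P σ s τ → Exec Q τ t υ → Exec (.seq P Q) σ (s + t) υ
  | iteTrue {b : Test} {P Q : Prog} {σ τ : Store} {t : ℕ} :
      b.eval σ → Exec P σ t τ → Exec (.ite b P Q) σ (b.cost + 1 + t) τ
  | iteFalse {b : Test} {P Q : Prog} {σ τ : Store} {t : ℕ} :
      ¬ b.eval σ → Exec Q σ t τ → Exec (.ite b P Q) σ (b.cost + 1 + t) τ
  | loopTrue {b : Test} {P : Prog} {σ τ υ : Store} {s t : ℕ} :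
      b.eval σ → Exec P σ s τ → Exec (.loop b P) τ t υ →
        Exec (.loop b P) σ (b.cost + 1 + s + t) υ
  | loopFalse {b : Test} {P : Prog} {σ : Store} :
      ¬ b.eval σ → Exec (.loop b P) σ (b.cost + 1) σ

/-- Programs are deterministic: the running time and the final memory state are unique. -/
theorem Exec.unique {P : Prog} {σ τ τ' : Store} {t t' : ℕ}
    (h : Exec P σ t τ) (h' : Exec P σ t' τ') : t = t' ∧ τ = τ' := by
  induction h generalizing t' τ' with
  | skip | setNat | setReal | writeNat | writeReal => cases h'; exact ⟨rfl, rfl⟩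
  | seq _ _ ih₁ ih₂ =>
    cases h' with
    | seq a b =>
      obtain ⟨rfl, rfl⟩ := ih₁ a
      obtain ⟨rfl, rfl⟩ := ih₂ b
      exact ⟨rfl, rfl⟩
  | iteTrue hb _ ih =>
    cases h' with
    | iteTrue _ a => obtain ⟨rfl, rfl⟩ := ih a; exact ⟨rfl, rfl⟩
    | iteFalse hn _ => exact absurd hb hn
  | iteFalse hb _ ih =>
    cases h' with
    | iteTrue hp _ => exact absurd hp hb
    | iteFalse _ a => obtain ⟨rfl, rfl⟩ := ih a; exact ⟨rfl, rfl⟩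
  | loopTrue hb _ _ ih₁ ih₂ =>
    cases h' with
    | loopTrue _ a b =>
      obtain ⟨rfl, rfl⟩ := ih₁ a
      obtain ⟨rfl, rfl⟩ := ih₂ b
      exact ⟨rfl, rfl⟩
    | loopFalse hn => exact absurd hb hn
  | loopFalse hb =>
    cases h' with
    | loopTrue hp _ _ => exact absurd hp hb
    | loopFalse _ => exact ⟨rfl, rfl⟩

/-- The memory state holds an instance of touring balls: the number `n` of balls in natural variable
`0`, the accuracy `ε` in real variable `0`, and in real arrays `0`, `1`, `2`, `3` the start, the
end, the centres (one after the other) and the radii. The rest of the memory is arbitrary. -/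
structure HoldsInput {d n : ℕ} (σ : Store) (ε : ℝ) (start finish : Space d)
    (c : Fin n → Space d) (r : Fin n → ℝ) : Prop where
  size : σ.natVar 0 = n
  accuracy : σ.realVar 0 = ε
  start : ∀ j : Fin d, σ.realArr 0 j = start j
  finish : ∀ j : Fin d, σ.realArr 1 j = finish j
  centres : ∀ (i : Fin n) (j : Fin d), σ.realArr 2 (i * d + j) = c i j
  radii : ∀ i : Fin n, σ.realArr 3 i = r i

/-- The list of `n` points of `d`-dimensional space that the memory state holds, one after the
other, in real array `4`. -/
noncomputable def outputPoints (d n : ℕ) (σ : Store) : Fin n → Space d :=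
  fun i => WithLp.toLp 2 fun j => σ.realArr 4 (i * d + j)

end RealRAM

/-! The length of a path is the maximum, over edge vectors of norm at most one, of the bilinear form
`coupling`. A shortest tour is therefore the primal part of a convex-concave saddle point over
products of balls. The algorithm runs a primal-dual iteration with extrapolation, in which every
step is an explicit projection to a ball. By `primalDual_rate`, with step size τ_i at vertex i and
starting path x, the average of N iterates exceeds the length of any tour z by at most 1/N times ∑
‖x_i - z_i‖² / τ_i + 4 ∑ (τ_j + τ_{j+1}).

So O(1/ε) iterations suffice once, for a shortest tour z, ‖x_i - z_i‖ = O(τ_i) and ∑ τ_i is at most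
a constant times the optimum. The starting path is the greedy one, and τ_i is the sum of its edge
lengths, halved with each edge further away from i. Disjointness gives both properties through a
packing bound, `DisjointBalls.exists_radius_le`: among 5^d + 1 consecutive balls, one has radius at
most the length of the path through them. Any two tours are close at such a ball. The greedy error
at most doubles per step, up to an edge length, and starts afresh at each small ball, so the greedy
path is a constant-factor approximation (`DisjointBalls.greedy_le`). Splicing it into a shortest
tour between small balls on both sides of i bounds ‖x_i - z_i‖ (`DisjointBalls.dist_optimal_le`).
`DisjointBalls.average_le` combines these facts.

An iteration costs O(n + 1) steps on the real RAM, so the total is O((n + 1) / ε). For d ≥ 2 and ε ≤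
ε₀ < 1 this lies below the claimed bound. -/

section Touring

open Finset

/-! ### Projection to balls and the primal-dual iteration -/

section PrimalDual

variable {E : Type*} [NormedAddCommGroup E] [InnerProductSpace ℝ E]

/-- The point of the closed ball with centre `c` and radius `r` that is closest to `q`. -/
noncomputable def ballProj (c : E) (r : ℝ) (q : E) : E :=
  c + (if ‖q - c‖ < r then (1 : ℝ) else r / ‖q - c‖) • (q - c)

theorem ballProj_mem {r : ℝ} (hr : 0 ≤ r) (c q : E) : ballProj c r q ∈ Metric.closedBall c r := by
  unfold ballProj
  rw [mem_closedBall_iff_norm]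
  split_ifs with h
  · simpa using h.le
  · rw [add_sub_cancel_left, norm_smul, Real.norm_of_nonneg (by positivity)]
    -- A vanishing distance is possible here only for r = 0; the division by zero is then harmless.
    rcases eq_or_ne ‖q - c‖ 0 with h0 | h0
    · rw [h0, mul_zero]; exact hr
    · rw [div_mul_cancel₀ _ h0]

/-- This variational inequality of the projection is what the convergence proof uses at every
update. Outside the ball, q minus its projection is a nonnegative multiple of q - c, and
Cauchy-Schwarz applies. -/
theorem inner_sub_ballProj_nonpos {r : ℝ} {c q w : E}
    (hw : w ∈ Metric.closedBall c r) :
    inner ℝ (q - ballProj c r q) (w - ballProj c r q) ≤ 0 := by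
  rw [mem_closedBall_iff_norm] at hw
  unfold ballProj
  split_ifs with h
  · simp
  · rw [not_lt] at h
    rcases (norm_nonneg (q - c)).eq_or_lt with h0 | h0
    · have h1 : q - c = 0 := norm_eq_zero.1 h0.symm
      simp [h1]
    set ρ := ‖q - c‖ with hρ
    have h1 : q - (c + (r / ρ) • (q - c)) = (1 - r / ρ) • (q - c) := by module
    have h2 : w - (c + (r / ρ) • (q - c)) = (w - c) - (r / ρ) • (q - c) := by module
    have h3 : inner ℝ (q - c) (w - c) ≤ ρ * r :=
      (real_inner_le_norm _ _).trans (by gcongr)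
    rw [h1, h2, real_inner_smul_left, inner_sub_right, real_inner_smul_right,
      real_inner_self_eq_norm_sq, ← hρ]
    have h4 : r / ρ * ρ ^ 2 = ρ * r := by field_simp
    have h5 : 0 ≤ 1 - r / ρ := sub_nonneg.2 ((div_le_one h0).2 h)
    rw [h4]
    exact mul_nonpos_of_nonneg_of_nonpos h5 (by linarith)

theorem norm_sub_ballProj_le {r : ℝ} {c q w : E}
    (hw : w ∈ Metric.closedBall c r) : ‖q - ballProj c r q‖ ≤ ‖q - w‖ := by
  have h := inner_sub_ballProj_nonpos (q := q) hw
  set p := ballProj c r q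
  have h1 : w - p = (q - p) - (q - w) := by abel
  rw [h1, inner_sub_right, real_inner_self_eq_norm_sq] at h
  have h2 := real_inner_le_norm (q - p) (q - w)
  rcases (norm_nonneg (q - p)).eq_or_lt with h0 | h0
  · rw [← h0]; positivity
  · nlinarith

/-- The bilinear coupling between points `w₀, …, wₘ` and edge vectors `u₁, …, uₘ`. -/
noncomputable def coupling (m : ℕ) (w u : ℕ → E) : ℝ :=
  ∑ j ∈ range m, inner ℝ (w j - w (j + 1)) (u (j + 1))

/-- Summation by parts; the zero edge vectors at both ends remove the boundary terms. It identifies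
u (i + 1) - u i as the gradient of the coupling at vertex i, the direction of the primal step. -/
theorem sum_inner_eq_coupling (m : ℕ) (w u : ℕ → E) (h0 : u 0 = 0) (hm : u (m + 1) = 0) :
    ∑ i ∈ range (m + 1), inner ℝ (u (i + 1) - u i) (w i) = coupling m w u := by
  have key : ∀ k, ∑ i ∈ range (k + 1), inner ℝ (u (i + 1) - u i) (w i)
      = coupling k w u + inner ℝ (u (k + 1)) (w k) := by
    intro k
    induction k with
    | zero => simp [coupling, h0]
    | succ k ih =>
      rw [sum_range_succ, ih]
      simp only [coupling]
      rw [sum_range_succ]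
      rw [real_inner_comm (u (k + 1)) (w k - w (k + 1))]
      simp only [inner_sub_left, inner_sub_right]
      ring
  rw [key, hm, inner_zero_left, add_zero]

/-- The quadratic form that decreases along the primal-dual iteration. -/
noncomputable def energy (m : ℕ) (τ s : ℕ → ℝ) (a b : ℕ → E) : ℝ :=
  (∑ i ∈ range (m + 1), ‖a i‖ ^ 2 / τ i) / 2 + (∑ j ∈ range m, s j * ‖b (j + 1)‖ ^ 2) / 2
    - coupling m a b

/-- Weighted AM-GM on each edge. An edge charges a quarter of ‖a‖² / τ to each endpoint, and a
vertex has at most two edges, which gives the factor 1/2. The condition on s absorbs the dual terms.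
-/
theorem abs_coupling_le {m : ℕ} {τ s : ℕ → ℝ} (hτ : ∀ i ≤ m, 0 < τ i)
    (hs : ∀ j < m, 4 * (τ j + τ (j + 1)) ≤ s j) (a b : ℕ → E) :
    |coupling m a b| ≤ (∑ i ∈ range (m + 1), ‖a i‖ ^ 2 / τ i) / 2
      + (∑ j ∈ range m, s j * ‖b (j + 1)‖ ^ 2) / 2 := by
  have hedge : ∀ {t p q : ℝ}, 0 < t → p * q ≤ p ^ 2 / t / 4 + t * q ^ 2 := by
    intro t p q ht
    have : p ^ 2 / t / 4 + t * q ^ 2 - p * q = (p / 2 - t * q) ^ 2 / t := by field_simp; ring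
    have h2 : 0 ≤ (p / 2 - t * q) ^ 2 / t := by positivity
    linarith
  have h1 : |coupling m a b| ≤ ∑ j ∈ range m,
      (‖a j‖ ^ 2 / τ j / 4 + ‖a (j + 1)‖ ^ 2 / τ (j + 1) / 4 + s j * ‖b (j + 1)‖ ^ 2 / 4) := by
    refine (abs_sum_le_sum_abs _ _).trans (sum_le_sum fun j hj => ?_)
    rw [mem_range] at hj
    have e1 := hedge (p := ‖a j‖) (q := ‖b (j + 1)‖) (hτ j hj.le)
    have e2 := hedge (p := ‖a (j + 1)‖) (q := ‖b (j + 1)‖) (hτ (j + 1) hj)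
    have e3 := (abs_real_inner_le_norm (a j - a (j + 1)) (b (j + 1))).trans
      (mul_le_mul_of_nonneg_right (norm_sub_le _ _) (norm_nonneg _))
    have e4 := mul_le_mul_of_nonneg_right (hs j hj) (sq_nonneg ‖b (j + 1)‖)
    nlinarith
  have h2 : ∑ j ∈ range m, ‖a j‖ ^ 2 / τ j ≤ ∑ i ∈ range (m + 1), ‖a i‖ ^ 2 / τ i := by
    rw [sum_range_succ]
    have := hτ m le_rfl
    have : 0 ≤ ‖a m‖ ^ 2 / τ m := by positivity
    linarith
  have h3 : ∑ j ∈ range m, ‖a (j + 1)‖ ^ 2 / τ (j + 1)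
      ≤ ∑ i ∈ range (m + 1), ‖a i‖ ^ 2 / τ i := by
    rw [sum_range_succ']
    have := hτ 0 (Nat.zero_le _)
    have : 0 ≤ ‖a 0‖ ^ 2 / τ 0 := by positivity
    linarith
  have h4 : 0 ≤ ∑ j ∈ range m, s j * ‖b (j + 1)‖ ^ 2 := by
    refine sum_nonneg fun j hj => mul_nonneg ?_ (sq_nonneg _)
    rw [mem_range] at hj
    have := hs j hj
    have := hτ j hj.le
    have := hτ (j + 1) hj
    linarith
  rw [sum_add_distrib, sum_add_distrib, ← sum_div, ← sum_div, ← sum_div] at h1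
  linarith

theorem energy_nonneg {m : ℕ} {τ s : ℕ → ℝ} (hτ : ∀ i ≤ m, 0 < τ i)
    (hs : ∀ j < m, 4 * (τ j + τ (j + 1)) ≤ s j) (a b : ℕ → E) : 0 ≤ energy m τ s a b := by
  have := (abs_le.1 (abs_coupling_le hτ hs a b)).2
  unfold energy
  linarith

theorem energy_le {m : ℕ} {τ s : ℕ → ℝ} (hτ : ∀ i ≤ m, 0 < τ i)
    (hs : ∀ j < m, 4 * (τ j + τ (j + 1)) ≤ s j) (a b : ℕ → E) :
    energy m τ s a b ≤ (∑ i ∈ range (m + 1), ‖a i‖ ^ 2 / τ i)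
      + ∑ j ∈ range m, s j * ‖b (j + 1)‖ ^ 2 := by
  have := (abs_le.1 (abs_coupling_le hτ hs a b)).1
  unfold energy
  linarith

theorem inner_sub_sub_eq (x y z : E) :
    inner ℝ (x - y) (y - z) = (‖x - z‖ ^ 2 - ‖x - y‖ ^ 2 - ‖y - z‖ ^ 2) / 2 := by
  have h : x - z = (x - y) + (y - z) := by abel
  rw [h, norm_add_sq_real]
  ring

/-- One step of the primal-dual iteration. -/
theorem primalDual_step {m : ℕ} {τ s : ℕ → ℝ} (hτ : ∀ i ≤ m, 0 < τ i) (hs : ∀ j < m, 0 < s j)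
    {x x' u u' z v : ℕ → E} (h0 : u 0 = 0) (hm : u (m + 1) = 0)
    (hx : ∀ i ≤ m, inner ℝ (x i - τ i • (u (i + 1) - u i) - x' i) (z i - x' i) ≤ 0)
    (hu : ∀ j < m, inner ℝ (u (j + 1) + (1 / s j) • ((2 • x' j - x j)
      - (2 • x' (j + 1) - x (j + 1))) - u' (j + 1)) (v (j + 1) - u' (j + 1)) ≤ 0) :
    coupling m x' v - coupling m z u' ≤ energy m τ s (x - z) (u - v)
      - energy m τ s (x - x') (u - u') - energy m τ s (x' - z) (u' - v) := by
  have hvert : ∑ i ∈ range (m + 1), inner ℝ (u (i + 1) - u i) ((x' - z) i)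
      ≤ ∑ i ∈ range (m + 1), (‖(x - z) i‖ ^ 2 / τ i - ‖(x - x') i‖ ^ 2 / τ i
        - ‖(x' - z) i‖ ^ 2 / τ i) / 2 := by
    refine sum_le_sum fun i hi => ?_
    have hi : i ≤ m := Nat.lt_succ_iff.1 (mem_range.1 hi)
    have ht := hτ i hi
    have h := hx i hi
    have e : x i - τ i • (u (i + 1) - u i) - x' i = (x i - x' i) - τ i • (u (i + 1) - u i) := by
      abel
    have e2 : z i - x' i = -(x' i - z i) := by abel
    rw [e, e2, inner_neg_right, inner_sub_left, inner_sub_sub_eq, real_inner_smul_left] at h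
    simp only [Pi.sub_apply]
    rw [← sub_div, ← sub_div, div_right_comm, le_div_iff₀ ht]
    linarith
  rw [sum_inner_eq_coupling m _ u h0 hm] at hvert
  have hedge : ∑ j ∈ range m, inner ℝ ((2 • x' j - x j) - (2 • x' (j + 1) - x (j + 1)))
        (v (j + 1) - u' (j + 1))
      ≤ ∑ j ∈ range m, (s j * ‖(u - v) (j + 1)‖ ^ 2 - s j * ‖(u - u') (j + 1)‖ ^ 2
        - s j * ‖(u' - v) (j + 1)‖ ^ 2) / 2 := by
    refine sum_le_sum fun j hj => ?_
    have hj : j < m := mem_range.1 hj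
    have ht := hs j hj
    have h := hu j hj
    set D := (2 • x' j - x j) - (2 • x' (j + 1) - x (j + 1))
    have e : u (j + 1) + (1 / s j) • D - u' (j + 1)
        = (u (j + 1) - u' (j + 1)) + (1 / s j) • D := by abel
    have e2 : inner ℝ (u (j + 1) - u' (j + 1)) (v (j + 1) - u' (j + 1))
        = - ((‖u (j + 1) - v (j + 1)‖ ^ 2 - ‖u (j + 1) - u' (j + 1)‖ ^ 2
          - ‖u' (j + 1) - v (j + 1)‖ ^ 2) / 2) := by
      rw [← inner_sub_sub_eq, ← inner_neg_right, neg_sub]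
    rw [e, inner_add_left, e2, real_inner_smul_left] at h
    simp only [Pi.sub_apply]
    have h' := mul_le_mul_of_nonneg_left h ht.le
    rw [mul_add, ← mul_assoc (s j) (1 / s j), mul_one_div_cancel ht.ne'] at h'
    linarith
  -- This identity is the purpose of the extrapolation 2x' - x: the bilinear remainders become
  -- exactly the coupling terms of the three energies.
  have hid : coupling m (x' - z) u + (∑ j ∈ range m,
        inner ℝ ((2 • x' j - x j) - (2 • x' (j + 1) - x (j + 1))) (v (j + 1) - u' (j + 1)))
      = coupling m x' v - coupling m z u' + coupling m (x - z) (u - v)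
        - coupling m (x - x') (u - u') - coupling m (x' - z) (u' - v) := by
    simp only [coupling, ← sum_add_distrib, ← sum_sub_distrib]
    refine sum_congr rfl fun j _ => ?_
    simp only [Pi.sub_apply, inner_sub_left, inner_sub_right, two_smul, inner_add_left]
    ring
  simp only [sum_sub_distrib, ← sum_div] at hvert hedge
  unfold energy
  linarith

/-- The convergence rate of the primal-dual iteration for the length of a polygonal path. -/
theorem primalDual_rate {m : ℕ} {τ r : ℕ → ℝ} {c : ℕ → E} (hτ : ∀ i ≤ m, 0 < τ i)
    (x u : ℕ → ℕ → E)
    (hu0 : ∀ k, u k 0 = 0) (hum : ∀ k, u k (m + 1) = 0) (huz : u 0 = 0)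
    (hx : ∀ k, ∀ i ≤ m, x (k + 1) i = ballProj (c i) (r i) (x k i - τ i • (u k (i + 1) - u k i)))
    (hu : ∀ k, ∀ j < m, u (k + 1) (j + 1) = ballProj 0 1 (u k (j + 1)
      + (1 / (4 * (τ j + τ (j + 1)))) • ((2 • x (k + 1) j - x k j)
        - (2 • x (k + 1) (j + 1) - x k (j + 1)))))
    (z : ℕ → E) (hz : ∀ i ≤ m, z i ∈ Metric.closedBall (c i) (r i)) (N : ℕ) :
    ∑ j ∈ range m, dist (∑ k ∈ range N, x (k + 1) j) (∑ k ∈ range N, x (k + 1) (j + 1))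
      ≤ N * (∑ j ∈ range m, dist (z j) (z (j + 1)))
        + ((∑ i ∈ range (m + 1), ‖x 0 i - z i‖ ^ 2 / τ i)
          + ∑ j ∈ range m, 4 * (τ j + τ (j + 1))) := by
  set s : ℕ → ℝ := fun j => 4 * (τ j + τ (j + 1)) with hs
  set S : ℕ → E := fun i => ∑ k ∈ range N, x (k + 1) i with hS
  -- The dual competitor: the unit vector along edge i of the summed path, where the coupling
  -- attains the length. For a degenerate edge the inverse of zero makes it 0.
  set v : ℕ → E := fun i => ‖S (i - 1) - S i‖⁻¹ • (S (i - 1) - S i) with hv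
  have hspos : ∀ j < m, 0 < s j := fun j hj => by
    have := hτ j hj.le
    have := hτ (j + 1) hj
    simp only [hs]; positivity
  have hvn : ∀ i, ‖v i‖ ≤ 1 := fun i => by
    simp only [hv, norm_smul, norm_inv, norm_norm]
    exact inv_mul_le_one
  have hun : ∀ k, ∀ j < m, ‖u k (j + 1)‖ ≤ 1 := by
    intro k j hj
    cases k with
    | zero => simp [huz]
    | succ k =>
      rw [hu k j hj]
      simpa using ballProj_mem zero_le_one (0 : E) _
  have hstep : ∀ k, coupling m (x (k + 1)) v - coupling m z (u (k + 1))
      ≤ energy m τ s (x k - z) (u k - v) - energy m τ s (x (k + 1) - z) (u (k + 1) - v) := by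
    intro k
    have h1 := primalDual_step hτ hspos (hu0 k) (hum k) (x := x k) (x' := x (k + 1))
      (u' := u (k + 1)) (z := z) (v := v)
      (fun i hi => by rw [hx k i hi]; exact inner_sub_ballProj_nonpos (hz i hi))
      (fun j hj => by
        rw [hu k j hj]
        exact inner_sub_ballProj_nonpos (by simpa using hvn (j + 1)))
    have h2 := energy_nonneg hτ (fun j _ => le_refl (s j)) (x k - x (k + 1)) (u k - u (k + 1))
    linarith
  -- The energies telescope, and the last one is dropped because it is nonnegative.
  have htel : ∑ k ∈ range N, (coupling m (x (k + 1)) v - coupling m z (u (k + 1)))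
      ≤ energy m τ s (x 0 - z) (u 0 - v) := by
    refine (sum_le_sum fun k _ => hstep k).trans ?_
    rw [sum_range_sub' (fun k => energy m τ s (x k - z) (u k - v))]
    have := energy_nonneg hτ (fun j _ => le_refl (s j)) (x N - z) (u N - v)
    linarith
  have hen : energy m τ s (x 0 - z) (u 0 - v) ≤ (∑ i ∈ range (m + 1), ‖x 0 i - z i‖ ^ 2 / τ i)
      + ∑ j ∈ range m, s j := by
    refine (energy_le hτ (fun j _ => le_refl (s j)) _ _).trans ?_
    refine add_le_add le_rfl (sum_le_sum fun j hj => ?_)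
    rw [huz, zero_sub, Pi.neg_apply, norm_neg]
    have := hvn (j + 1)
    have h2 : ‖v (j + 1)‖ ^ 2 ≤ 1 := pow_le_one₀ (norm_nonneg _) this
    exact mul_le_of_le_one_right (hspos j (mem_range.1 hj)).le h2
  have hdual : ∀ k, coupling m z (u (k + 1)) ≤ ∑ j ∈ range m, dist (z j) (z (j + 1)) := by
    intro k
    refine sum_le_sum fun j hj => ?_
    rw [dist_eq_norm]
    exact (real_inner_le_norm _ _).trans
      (mul_le_of_le_one_right (norm_nonneg _) (hun _ j (mem_range.1 hj)))
  have hprim : ∑ k ∈ range N, coupling m (x (k + 1)) v = ∑ j ∈ range m, dist (S j) (S (j + 1)) := by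
    simp only [coupling]
    rw [sum_comm]
    refine sum_congr rfl fun j _ => ?_
    rw [← sum_inner, sum_sub_distrib]
    change inner ℝ (S j - S (j + 1)) (‖S j - S (j + 1)‖⁻¹ • (S j - S (j + 1))) = _
    rw [real_inner_smul_right, real_inner_self_eq_norm_sq, dist_eq_norm, pow_two, ← mul_assoc]
    rcases eq_or_ne ‖S j - S (j + 1)‖ 0 with h | h
    · simp [h]
    · rw [inv_mul_cancel₀ h, one_mul]
  rw [sum_sub_distrib, hprim] at htel
  have h3 : ∑ k ∈ range N, coupling m z (u (k + 1))
      ≤ N * ∑ j ∈ range m, dist (z j) (z (j + 1)) := by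
    simpa using sum_le_card_nsmul (range N) _ _ fun k _ => hdual k
  linarith

end PrimalDual

/-! ### Exponential smoothing of edge lengths -/

section Smoothing

/-- Exponentially smoothed partial sums of a sequence. -/
noncomputable def smooth (l : ℕ → ℝ) : ℕ → ℝ
  | 0 => 0
  | i + 1 => smooth l i / 2 + l i

theorem smooth_nonneg {l : ℕ → ℝ} (hl : ∀ i, 0 ≤ l i) (i : ℕ) : 0 ≤ smooth l i := by
  induction i with
  | zero => exact le_rfl
  | succ i ih => rw [smooth]; linarith [hl i]

/-- In `smooth l j` the term l k has weight 2 ^ (-(j - 1 - k)), which exceeds 2 ^ (-K) throughout a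
window of length K. Local path lengths are thereby controlled by the smoothed sum. -/
theorem sum_Ico_le_smooth {l : ℕ → ℝ} (hl : ∀ i, 0 ≤ l i) {i j K : ℕ} (h : j ≤ i + K) :
    ∑ k ∈ Ico i j, l k ≤ 2 ^ K * smooth l j := by
  induction j generalizing K with
  | zero => simp [smooth]
  | succ j ih =>
    rcases Nat.lt_or_ge j i with hji | hij
    · rw [Ico_eq_empty (by omega), sum_empty]
      exact mul_nonneg (by positivity) (smooth_nonneg hl _)
    · obtain ⟨K, rfl⟩ : ∃ K', K = K' + 1 := ⟨K - 1, by omega⟩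
      have h1 := ih (K := K) (by omega)
      have h2 : (1 : ℝ) ≤ 2 ^ (K + 1) := one_le_pow₀ (by norm_num)
      rw [sum_Ico_succ_top hij, smooth, mul_add]
      have h3 := mul_le_mul_of_nonneg_right h2 (hl j)
      rw [pow_succ] at h3 ⊢
      linarith

/-- Each l j contributes a geometric series with sum at most 2, so smoothing keeps the total
proportional to the path length. -/
theorem sum_smooth_le {l : ℕ → ℝ} (hl : ∀ i, 0 ≤ l i) (m : ℕ) :
    ∑ i ∈ range (m + 1), smooth l i ≤ 2 * ∑ j ∈ range m, l j := by
  have h1 := sum_range_succ' (smooth l) m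
  have h2 := sum_range_succ (smooth l) m
  simp only [smooth, sum_add_distrib, ← sum_div] at h1
  linarith [smooth_nonneg hl m]

/-- Exponentially smoothed sums, from the last of `m` terms backwards. -/
noncomputable def smoothRev (m : ℕ) (l : ℕ → ℝ) (i : ℕ) : ℝ :=
  smooth (fun k => l (m - 1 - k)) (m - i)

theorem smoothRev_self (m : ℕ) (l : ℕ → ℝ) : smoothRev m l m = 0 := by
  simp [smoothRev, smooth]

theorem smoothRev_of_lt {m : ℕ} (l : ℕ → ℝ) {i : ℕ} (h : i < m) :
    smoothRev m l i = smoothRev m l (i + 1) / 2 + l i := by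
  obtain ⟨k, rfl⟩ := Nat.exists_eq_add_of_lt h
  have h1 : i + k + 1 - i = k + 1 := by omega
  have h2 : i + k + 1 - (i + 1) = k := by omega
  have h3 : i + k + 1 - 1 - k = i := by omega
  rw [smoothRev, smoothRev, h1, h2, smooth, h3]

theorem smoothRev_nonneg {l : ℕ → ℝ} (hl : ∀ i, 0 ≤ l i) (m i : ℕ) : 0 ≤ smoothRev m l i :=
  smooth_nonneg (fun _ => hl _) _

theorem sum_Ico_le_smoothRev {l : ℕ → ℝ} (hl : ∀ i, 0 ≤ l i) {m i j K : ℕ} (h : j ≤ i + K)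
    (hj : j ≤ m) : ∑ k ∈ Ico i j, l k ≤ 2 ^ K * smoothRev m l i := by
  induction K generalizing i with
  | zero =>
    rw [Ico_eq_empty (by omega), sum_empty]
    exact mul_nonneg (by positivity) (smoothRev_nonneg hl _ _)
  | succ K ih =>
    rcases Nat.lt_or_ge i j with hij | hji
    · have h1 := ih (i := i + 1) (by omega)
      have h2 : (1 : ℝ) ≤ 2 ^ (K + 1) := one_le_pow₀ (by norm_num)
      rw [sum_eq_sum_Ico_succ_bot hij, smoothRev_of_lt l (by omega : i < m), mul_add]
      have h3 := mul_le_mul_of_nonneg_right h2 (hl i)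
      rw [pow_succ] at h3 ⊢
      linarith
    · rw [Ico_eq_empty (by omega), sum_empty]
      exact mul_nonneg (by positivity) (smoothRev_nonneg hl _ _)

theorem sum_smoothRev_le {l : ℕ → ℝ} (hl : ∀ i, 0 ≤ l i) (m : ℕ) :
    ∑ i ∈ range (m + 1), smoothRev m l i ≤ 2 * ∑ j ∈ range m, l j := by
  have h1 := sum_range_succ' (smoothRev m l) m
  have h2 := sum_range_succ (smoothRev m l) m
  have h3 : ∑ i ∈ range m, smoothRev m l i
      = (∑ i ∈ range m, smoothRev m l (i + 1)) / 2 + ∑ i ∈ range m, l i := by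
    rw [sum_div, ← sum_add_distrib]
    exact sum_congr rfl fun i hi => smoothRev_of_lt l (mem_range.1 hi)
  rw [smoothRev_self] at h2
  linarith [smoothRev_nonneg hl m 0]

end Smoothing

/-! ### Packing of disjoint balls, the greedy path and local closeness of tours -/

section Packing

variable {E : Type*} [NormedAddCommGroup E]

/-- The balls `0, …, m` are pairwise disjoint, and the first and the last are points. -/
structure DisjointBalls (m : ℕ) (c : ℕ → E) (r : ℕ → ℝ) : Prop where
  nonneg : ∀ i ≤ m, 0 ≤ r i
  first : r 0 = 0
  last : r m = 0
  disjoint : ∀ i ≤ m, ∀ j ≤ m, i ≠ j →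
    Disjoint (Metric.closedBall (c i) (r i)) (Metric.closedBall (c j) (r j))

/-- `z` visits the balls `0, …, m`. -/
def Visits (m : ℕ) (c : ℕ → E) (r : ℕ → ℝ) (z : ℕ → E) : Prop :=
  ∀ i ≤ m, z i ∈ Metric.closedBall (c i) (r i)

/-- The length of the `k`-th edge of a path. -/
noncomputable def edge (z : ℕ → E) (k : ℕ) : ℝ := dist (z k) (z (k + 1))

theorem edge_nonneg (z : ℕ → E) (k : ℕ) : 0 ≤ edge z k := dist_nonneg

theorem sum_edge_nonneg (z : ℕ → E) (s : Finset ℕ) : 0 ≤ ∑ k ∈ s, edge z k :=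
  sum_nonneg fun k _ => edge_nonneg z k

variable {m : ℕ} {c : ℕ → E} {r : ℕ → ℝ}

theorem DisjointBalls.edge_pos (h : DisjointBalls m c r) {z : ℕ → E} (hz : Visits m c r z)
    {k : ℕ} (hk : k < m) : 0 < edge z k := by
  refine dist_pos.2 fun e => ?_
  refine Set.disjoint_left.1 (h.disjoint k hk.le (k + 1) hk (by omega)) (hz k hk.le) ?_
  rw [e]
  exact hz (k + 1) hk

theorem Visits.dist_le {z g : ℕ → E} (hg : Visits m c r g) (hz : Visits m c r z) {k : ℕ}
    (hk : k ≤ m) : dist (g k) (z k) ≤ 2 * r k := by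
  have h1 := Metric.mem_closedBall.1 (hg k hk)
  have h2 := Metric.mem_closedBall'.1 (hz k hk)
  linarith [dist_triangle (g k) (c k) (z k)]

variable [InnerProductSpace ℝ E] [FiniteDimensional ℝ E]

/-- A path through more disjoint balls than `5 ^ dim` is at least as long as their smallest
radius. -/
theorem DisjointBalls.exists_radius_le (h : DisjointBalls m c r) {z : ℕ → E}
    (hz : Visits m c r z) {i : ℕ} (hi : i + 5 ^ Module.finrank ℝ E ≤ m) :
    ∃ k, i ≤ k ∧ k ≤ i + 5 ^ Module.finrank ℝ E ∧
      r k ≤ ∑ k ∈ Ico i (i + 5 ^ Module.finrank ℝ E), edge z k := by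
  set K := 5 ^ Module.finrank ℝ E with hK
  have hK1 : 1 ≤ K := Nat.one_le_pow _ _ (by norm_num)
  set w := ∑ k ∈ Ico i (i + K), edge z k with hw
  by_contra! hcon
  have hw0 : 0 < w :=
    sum_pos (fun k hk => h.edge_pos hz (by rw [mem_Ico] at hk; omega)) ⟨i, by simp; omega⟩
  -- If all radii exceed the path length w, each visited point can be moved towards its centre by at
  -- most w so that the ball of radius w about the new point fits into the k-th ball. The new points
  -- stay within 2w of z i and are w-separated.
  set P : ℕ → E := fun k => z k + (w / r k) • (c k - z k) with hP
  have hr : ∀ k, i ≤ k → k ≤ i + K → 0 < r k := fun k h1 h2 => hw0.trans (hcon k h1 h2)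
  have hball : ∀ k, i ≤ k → k ≤ i + K →
      Metric.closedBall (P k) w ⊆ Metric.closedBall (c k) (r k) := by
    intro k h1 h2
    refine Metric.closedBall_subset_closedBall' ?_
    have hrk := hr k h1 h2
    have h3 := hcon k h1 h2
    have h4 : P k - c k = (1 - w / r k) • (z k - c k) := by simp only [hP]; module
    have h5 : 0 ≤ 1 - w / r k := sub_nonneg.2 ((div_le_one hrk).2 h3.le)
    have h6 := mem_closedBall_iff_norm.1 (hz k (h2.trans hi))
    rw [dist_eq_norm, h4, norm_smul, Real.norm_of_nonneg h5]
    have h7 := mul_le_mul_of_nonneg_left h6 h5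
    have h8 : (1 - w / r k) * r k = r k - w := by field_simp
    linarith
  have hnear : ∀ k, i ≤ k → k ≤ i + K → ‖P k - z i‖ ≤ 2 * w := by
    intro k h1 h2
    have hrk := hr k h1 h2
    have h3 : ‖P k - z k‖ ≤ w := by
      simp only [hP]
      rw [add_sub_cancel_left, norm_smul, Real.norm_of_nonneg (by positivity), div_mul_eq_mul_div,
        div_le_iff₀ hrk]
      have h6 := mem_closedBall_iff_norm'.1 (hz k (h2.trans hi))
      gcongr
    have h4 : dist (z i) (z k) ≤ w := (dist_le_Ico_sum_dist z h1).trans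
      (sum_le_sum_of_subset_of_nonneg (Ico_subset_Ico le_rfl h2) fun _ _ _ => dist_nonneg)
    rw [dist_comm, dist_eq_norm] at h4
    have h5 : P k - z i = (P k - z k) + (z k - z i) := by abel
    rw [h5]
    linarith [norm_add_le (P k - z k) (z k - z i)]
  have hfar : ∀ k, i ≤ k → k ≤ i + K → ∀ l, i ≤ l → l ≤ i + K → k ≠ l → w ≤ ‖P k - P l‖ := by
    intro k h1 h2 l h3 h4 hkl
    by_contra! hlt
    refine Set.disjoint_left.1 (h.disjoint k (h2.trans hi) l (h4.trans hi) hkl)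
      (hball k h1 h2 (?_ : P l ∈ _)) (hball l h3 h4 (Metric.mem_closedBall_self hw0.le))
    rw [mem_closedBall_iff_norm']
    exact hlt.le
  classical
  set q : ℕ → E := fun k => w⁻¹ • (P k - z i) with hq
  have hqd : ∀ k l, ‖q k - q l‖ = w⁻¹ * ‖P k - P l‖ := by
    intro k l
    simp only [hq]
    rw [← smul_sub, sub_sub_sub_cancel_right, norm_smul, Real.norm_of_nonneg (by positivity)]
  have hsep : ∀ k, i ≤ k → k ≤ i + K → ∀ l, i ≤ l → l ≤ i + K → k ≠ l → 1 ≤ ‖q k - q l‖ := by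
    intro k h1 h2 l h3 h4 hkl
    have := hfar k h1 h2 l h3 h4 hkl
    rw [hqd, inv_mul_eq_div]
    exact (one_le_div hw0).2 this
  have hinj : Set.InjOn q (Icc i (i + K) : Finset ℕ) := by
    intro k hk l hl hkl
    simp only [coe_Icc, Set.mem_Icc] at hk hl
    by_contra hne
    have := hsep k hk.1 hk.2 l hl.1 hl.2 hne
    rw [hkl, sub_self, norm_zero] at this
    linarith
  -- After scaling by 1/w, K + 1 points with mutual distances at least 1 lie in a ball of radius 2,
  -- which has room for only K = 5 ^ dim.
  have hcard := Besicovitch.card_le_of_separated ((Icc i (i + K)).image q)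
    (by
      intro y hy
      obtain ⟨k, hk, rfl⟩ := mem_image.1 hy
      rw [mem_Icc] at hk
      have := hnear k hk.1 hk.2
      simp only [hq]
      rw [norm_smul, Real.norm_of_nonneg (by positivity), inv_mul_eq_div]
      exact (div_le_iff₀ hw0).2 this)
    (by
      intro y hy y' hy' hne
      obtain ⟨k, hk, rfl⟩ := mem_image.1 hy
      obtain ⟨l, hl, rfl⟩ := mem_image.1 hy'
      rw [mem_Icc] at hk hl
      exact hsep k hk.1 hk.2 l hl.1 hl.2 fun e => hne (by rw [e]))
  rw [card_image_of_injOn hinj, Nat.card_Icc, ← hK] at hcard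
  omega

/-- When fewer than K balls precede i, the starting point serves as a ball of radius zero. -/
theorem DisjointBalls.exists_radius_le_before (h : DisjointBalls m c r) {z : ℕ → E}
    (hz : Visits m c r z) {i : ℕ} (hi : i ≤ m) :
    ∃ k ≤ i, i ≤ k + 5 ^ Module.finrank ℝ E ∧
      r k ≤ ∑ k ∈ Ico (i - 5 ^ Module.finrank ℝ E) i, edge z k := by
  set K := 5 ^ Module.finrank ℝ E with hK
  rcases Nat.lt_or_ge i K with hlt | hge
  · exact ⟨0, Nat.zero_le _, by omega, by rw [h.first]; exact sum_edge_nonneg _ _⟩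
  · obtain ⟨k, h1, h2, h3⟩ := h.exists_radius_le hz (i := i - K) (by omega)
    rw [← hK, Nat.sub_add_cancel hge] at h2 h3
    exact ⟨k, h2, by omega, h3⟩

theorem DisjointBalls.exists_radius_le_after (h : DisjointBalls m c r) {z : ℕ → E}
    (hz : Visits m c r z) {i : ℕ} (hi : i ≤ m) :
    ∃ k, i ≤ k ∧ k ≤ i + 5 ^ Module.finrank ℝ E ∧ k ≤ m ∧
      r k ≤ ∑ k ∈ Ico i (min m (i + 5 ^ Module.finrank ℝ E)), edge z k := by
  set K := 5 ^ Module.finrank ℝ E with hK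
  rcases Nat.lt_or_ge m (i + K) with hlt | hge
  · exact ⟨m, hi, hlt.le, le_rfl, by rw [h.last]; exact sum_edge_nonneg _ _⟩
  · obtain ⟨k, h1, h2, h3⟩ := h.exists_radius_le hz (i := i) hge
    rw [min_eq_right hge]
    exact ⟨k, h1, h2, h2.trans hge, h3⟩

/-- Going to the closest point of the next ball yields a constant-factor approximation. -/
theorem DisjointBalls.greedy_le (h : DisjointBalls m c r) {g x : ℕ → E}
    (hg : Visits m c r g) (hx : Visits m c r x)
    (hgr : ∀ i < m, g (i + 1) = ballProj (c (i + 1)) (r (i + 1)) (g i)) :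
    ∑ k ∈ range m, edge g k
      ≤ (8 * 4 ^ 5 ^ Module.finrank ℝ E + 1) * ∑ k ∈ range m, edge x k := by
  set K := 5 ^ Module.finrank ℝ E with hK
  set δ : ℕ → ℝ := fun i => dist (g i) (x i) with hδ
  -- The greedy step is no longer than a direct move to the competitor's next point.
  have hedge : ∀ i < m, edge g i ≤ δ i + edge x i := by
    intro i hi
    have h1 := norm_sub_ballProj_le (q := g i) (hx (i + 1) hi)
    rw [← hgr i hi, ← dist_eq_norm, ← dist_eq_norm] at h1
    exact h1.trans (dist_triangle _ _ _)
  have hstep : ∀ i < m, δ (i + 1) ≤ 2 * δ i + 2 * edge x i := by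
    intro i hi
    have h1 := hedge i hi
    have h2 := dist_triangle4 (g (i + 1)) (g i) (x i) (x (i + 1))
    rw [dist_comm (g (i + 1)) (g i)] at h2
    simp only [hδ, edge] at h1 ⊢
    linarith
  have hgrow : ∀ k i, k ≤ i → i ≤ m → ∀ L, i ≤ k + L →
      δ i ≤ 2 ^ L * (δ k + 2 * ∑ j ∈ Ico k i, edge x j) := by
    intro k i hki
    induction i, hki using Nat.le_induction with
    | base =>
      intro _ L _
      have h1 : (1 : ℝ) ≤ 2 ^ L := one_le_pow₀ (by norm_num)
      simp only [Ico_self, sum_empty, mul_zero, add_zero]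
      exact le_mul_of_one_le_left dist_nonneg h1
    | succ i hki ih =>
      intro him L hL
      obtain ⟨L, rfl⟩ : ∃ L', L = L' + 1 := ⟨L - 1, by omega⟩
      have h1 := ih (by omega) L (by omega)
      have h2 : (1 : ℝ) ≤ 2 ^ L := one_le_pow₀ (by norm_num)
      have h3 := hstep i him
      have h4 := mul_le_mul_of_nonneg_right h2 (edge_nonneg x i)
      rw [sum_Ico_succ_top hki, pow_succ]
      linarith [mul_nonneg (zero_le_one.trans h2) (edge_nonneg x i)]
  -- Start from a small ball at most K steps back: the deviation there is at most twice its radius,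
  -- and grows by at most 2 ^ K. Comparing the window with the smoothed sum costs another 2 ^ K.
  have hδs : ∀ i ≤ m, δ i ≤ 4 * 4 ^ K * smooth (edge x) i := by
    intro i hi
    obtain ⟨k, h1, h2, h3⟩ := h.exists_radius_le_before hx hi
    rw [← hK] at h2 h3
    have h4 := hgrow k i h1 hi K h2
    have h5 := hg.dist_le hx (h1.trans hi)
    have h6 : ∑ j ∈ Ico k i, edge x j ≤ ∑ j ∈ Ico (i - K) i, edge x j :=
      sum_le_sum_of_subset_of_nonneg (Ico_subset_Ico (by omega) le_rfl)
        fun _ _ _ => edge_nonneg _ _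
    have h7 := sum_Ico_le_smooth (edge_nonneg x) (i := i - K) (j := i) (K := K) (by omega)
    have h8 : (4 : ℝ) ^ K = 2 ^ K * 2 ^ K := by rw [← mul_pow]; norm_num
    rw [h8]
    calc δ i ≤ 2 ^ K * (δ k + 2 * ∑ j ∈ Ico k i, edge x j) := h4
      _ ≤ 2 ^ K * (4 * (2 ^ K * smooth (edge x) i)) := by
        gcongr
        simp only [hδ]
        linarith
      _ = _ := by ring
  calc ∑ k ∈ range m, edge g k
      ≤ ∑ k ∈ range m, (4 * 4 ^ K * smooth (edge x) k + edge x k) :=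
        sum_le_sum fun k hk => by
          rw [mem_range] at hk
          linarith [hedge k hk, hδs k hk.le]
    _ = 4 * 4 ^ K * ∑ k ∈ range m, smooth (edge x) k + ∑ k ∈ range m, edge x k := by
        rw [sum_add_distrib, mul_sum]
    _ ≤ 4 * 4 ^ K * (2 * ∑ k ∈ range m, edge x k) + ∑ k ∈ range m, edge x k := by
        have h1 := sum_smooth_le (edge_nonneg x) m
        rw [sum_range_succ] at h1
        have h2 := smooth_nonneg (edge_nonneg x) m
        gcongr
        linarith
    _ = _ := by ring

/-- Any path through the balls is locally close to a shortest one, at the scale of its own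
edges. -/
theorem DisjointBalls.dist_optimal_le (h : DisjointBalls m c r) {g x : ℕ → E}
    (hg : Visits m c r g) (hx : Visits m c r x)
    (hopt : ∀ y, Visits m c r y → ∑ k ∈ range m, edge x k ≤ ∑ k ∈ range m, edge y k)
    {i : ℕ} (hi : i ≤ m) :
    dist (g i) (x i) ≤ 6 * 2 ^ 5 ^ Module.finrank ℝ E
      * (smooth (edge g) i + smoothRev m (edge g) i) := by
  set K := 5 ^ Module.finrank ℝ E with hK
  obtain ⟨p, hp1, hp2, hp3⟩ := h.exists_radius_le_before hg hi
  obtain ⟨q, hq1, hq2, hq3, hq4⟩ := h.exists_radius_le_after hg hi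
  rw [← hK] at hp2 hp3 hq2 hq4
  have hpm : p ≤ m := hp1.trans hi
  have hdp := hg.dist_le hx hpm
  have hdq := hg.dist_le hx hq3
  have ha := sum_Ico_le_smooth (edge_nonneg g) (i := i - K) (j := i) (K := K) (by omega)
  have hb := sum_Ico_le_smoothRev (edge_nonneg g) (m := m) (i := i) (j := min m (i + K)) (K := K)
    (min_le_right _ _) (min_le_left _ _)
  have ha' := sum_Ico_le_smooth (edge_nonneg g) (i := p) (j := i) (K := K) hp2
  have hb' := sum_Ico_le_smoothRev (edge_nonneg g) (m := m) (i := i) (j := q) (K := K) hq2 hq3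
  have hsplit := sum_Ico_consecutive (edge g) hp1 hq1
  -- Optimality of x against the tour that follows g from p to q and x elsewhere. The two detours at
  -- p and q are the only extra cost.
  have hlocal : ∑ k ∈ Ico p q, edge x k
      ≤ dist (g p) (x p) + ∑ k ∈ Ico p q, edge g k + dist (g q) (x q) := by
    have h1 := hopt (fun k => if p ≤ k ∧ k ≤ q then g k else x k) fun k hk => by
      dsimp only
      split_ifs
      exacts [hg k hk, hx k hk]
    have h2 : ∑ k ∈ range m, edge (fun k => if p ≤ k ∧ k ≤ q then g k else x k) k
        ≤ ∑ k ∈ range m, (edge x k + (if k ∈ Ico p q then edge g k - edge x k else 0)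
          + (if k + 1 = p then dist (g p) (x p) else 0)
          + (if k = q then dist (g q) (x q) else 0)) := by
      refine sum_le_sum fun k _ => ?_
      -- The edge is inside the spliced stretch, enters it at p, leaves it at q, or is unchanged.
      have n1 : 0 ≤ dist (g p) (x p) := dist_nonneg
      have n2 : 0 ≤ dist (g q) (x q) := dist_nonneg
      simp only [edge, mem_Ico]
      by_cases c1 : p ≤ k ∧ k < q
      · rw [if_pos (by omega), if_pos (by omega), if_pos c1, if_neg (by omega), if_neg (by omega)]
        linarith
      · rw [if_neg c1]
        by_cases c2 : k + 1 = p
        · rw [if_neg (by omega), if_pos (by omega), if_pos c2, c2, if_neg (by omega)]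
          linarith [dist_triangle (x k) (x p) (g p), dist_comm (g p) (x p)]
        · rw [if_neg c2]
          by_cases c3 : k = q
          · rw [if_pos (by omega), if_neg (by omega), if_pos c3, c3]
            linarith [dist_triangle (g q) (x q) (x (q + 1))]
          · rw [if_neg (by omega), if_neg (by omega), if_neg c3]
            linarith
    rw [sum_add_distrib, sum_add_distrib, sum_add_distrib, ← sum_filter] at h2
    have h3 : (range m).filter (fun k => k ∈ Ico p q) = Ico p q := by
      ext k
      simp only [mem_filter, mem_range, mem_Ico]
      omega
    have h4 : ∑ k ∈ range m, (if k + 1 = p then dist (g p) (x p) else 0) ≤ dist (g p) (x p) := by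
      rcases Nat.eq_zero_or_pos p with h0 | h0
      · rw [sum_eq_zero fun k _ => if_neg (by omega)]
        exact dist_nonneg
      · have : ∀ k, (k + 1 = p) = (k = p - 1) := fun k => by
          apply propext; omega
        simp only [this, sum_ite_eq']
        split_ifs
        exacts [le_rfl, dist_nonneg]
    have h5 : ∑ k ∈ range m, (if k = q then dist (g q) (x q) else 0) ≤ dist (g q) (x q) := by
      rw [sum_ite_eq']
      split_ifs
      exacts [le_rfl, dist_nonneg]
    rw [h3, sum_sub_distrib] at h2
    linarith
  have hgi := dist_le_Ico_sum_dist g hp1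
  have hxi := dist_le_Ico_sum_dist x hp1
  have hxi' : ∑ k ∈ Ico p i, edge x k ≤ ∑ k ∈ Ico p q, edge x k :=
    sum_le_sum_of_subset_of_nonneg (Ico_subset_Ico le_rfl hq1) fun _ _ _ => edge_nonneg _ _
  -- Travel along g back to p, cross to x, and follow x to i. With A and B the bounds for the left
  -- and right windows, this totals 6A + 3B.
  have htri := dist_triangle4 (g i) (g p) (x p) (x i)
  rw [dist_comm (g i) (g p)] at htri
  simp only [edge] at *
  have hB : 0 ≤ smoothRev m (fun k => dist (g k) (g (k + 1))) i :=
    smoothRev_nonneg (fun _ => dist_nonneg) _ _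
  have hP : (0 : ℝ) ≤ 2 ^ K * smoothRev m (fun k => dist (g k) (g (k + 1))) i := by positivity
  have e1 : smooth (edge g) i = smooth (fun k => dist (g k) (g (k + 1))) i := rfl
  have e2 : smoothRev m (edge g) i = smoothRev m (fun k => dist (g k) (g (k + 1))) i := rfl
  rw [e1] at ha ha'
  rw [e2] at hb hb'
  rw [e1, e2]
  linarith

end Packing

/-! ### The approximation guarantee with local step sizes -/

section Guarantee

variable {E : Type*} [NormedAddCommGroup E] {m : ℕ} {c : ℕ → E} {r : ℕ → ℝ}

/-- The step size at each vertex: a two-sided smoothed edge length. -/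
noncomputable def stepSize (m : ℕ) (g : ℕ → E) (i : ℕ) : ℝ :=
  smooth (edge g) i + smoothRev m (edge g) i

/-- After `touringConst d / ε` iterations, the average is a `(1 + ε)`-approximation. -/
def touringConst (d : ℕ) : ℕ := (4 * (6 * 2 ^ 5 ^ d) ^ 2 + 32) * (8 * 4 ^ 5 ^ d + 1)

theorem touringConst_pos (d : ℕ) : 0 < touringConst d := by unfold touringConst; positivity

/-- An edge incident to i enters with weight one, and it has positive length because the balls are
disjoint. -/
theorem DisjointBalls.stepSize_pos (h : DisjointBalls m c r) (hm : 0 < m) {g : ℕ → E}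
    (hg : Visits m c r g) {i : ℕ} (hi : i ≤ m) : 0 < stepSize m g i := by
  unfold stepSize
  cases i with
  | zero =>
    rw [smoothRev_of_lt _ hm]
    linarith [h.edge_pos hg hm, smooth_nonneg (edge_nonneg g) 0,
      smoothRev_nonneg (edge_nonneg g) m (0 + 1)]
  | succ i =>
    rw [smooth]
    linarith [h.edge_pos hg hi, smooth_nonneg (edge_nonneg g) i,
      smoothRev_nonneg (edge_nonneg g) m (i + 1)]

theorem sum_stepSize_le (m : ℕ) (g : ℕ → E) :
    ∑ i ∈ range (m + 1), stepSize m g i ≤ 4 * ∑ k ∈ range m, edge g k := by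
  simp only [stepSize, sum_add_distrib]
  linarith [sum_smooth_le (edge_nonneg g) m, sum_smoothRev_le (edge_nonneg g) m]

variable [InnerProductSpace ℝ E] [FiniteDimensional ℝ E]

/-- The average of the iterates is a tour, and an approximately shortest one. -/
theorem DisjointBalls.average_le (h : DisjointBalls m c r) (hm : 0 < m) {g z : ℕ → E}
    (hg0 : g 0 = c 0) (hgr : ∀ i < m, g (i + 1) = ballProj (c (i + 1)) (r (i + 1)) (g i))
    (hz : Visits m c r z)
    (hopt : ∀ y, Visits m c r y → ∑ k ∈ range m, edge z k ≤ ∑ k ∈ range m, edge y k)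
    (x u : ℕ → ℕ → E) (hxg : ∀ i ≤ m, x 0 i = g i)
    (hu0 : ∀ k, u k 0 = 0) (hum : ∀ k, u k (m + 1) = 0) (huz : u 0 = 0)
    (hx : ∀ k, ∀ i ≤ m, x (k + 1) i
      = ballProj (c i) (r i) (x k i - stepSize m g i • (u k (i + 1) - u k i)))
    (hu : ∀ k, ∀ j < m, u (k + 1) (j + 1) = ballProj 0 1 (u k (j + 1)
      + (1 / (4 * (stepSize m g j + stepSize m g (j + 1)))) • ((2 • x (k + 1) j - x k j)
        - (2 • x (k + 1) (j + 1) - x k (j + 1)))))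
    {N : ℕ} {ε : ℝ} (hN : 0 < N)
    (hNε : (touringConst (Module.finrank ℝ E) : ℝ) ≤ N * ε) :
    Visits m c r (fun i => (N : ℝ)⁻¹ • ∑ k ∈ range N, x (k + 1) i) ∧
    ∑ j ∈ range m, edge (fun i => (N : ℝ)⁻¹ • ∑ k ∈ range N, x (k + 1) i) j
      ≤ (1 + ε) * ∑ k ∈ range m, edge z k := by
  have hN' : (0 : ℝ) < N := Nat.cast_pos.2 hN
  have hg : Visits m c r g := by
    intro i hi
    cases i with
    | zero => rw [hg0]; exact Metric.mem_closedBall_self (h.nonneg 0 hi)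
    | succ i => rw [hgr i hi]; exact ballProj_mem (h.nonneg _ hi) _ _
  constructor
  -- Feasibility survives averaging because the balls are convex.
  · intro i hi
    simp only [smul_sum]
    refine (convex_closedBall (c i) (r i)).sum_mem (fun _ _ => by positivity) ?_ fun k _ => ?_
    · simp [hN'.ne']
    · rw [hx k i hi]
      exact ballProj_mem (h.nonneg i hi) _ _
  set K := 5 ^ Module.finrank ℝ E with hK
  have hτ : ∀ i ≤ m, 0 < stepSize m g i := fun i hi => h.stepSize_pos hm hg hi
  have hrate := primalDual_rate hτ x u hu0 hum huz hx hu z hz N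
  -- The local distance bound makes each quotient at most a constant times the step size, and the
  -- step sizes sum to at most four greedy lengths.
  have h1 : ∑ i ∈ range (m + 1), ‖x 0 i - z i‖ ^ 2 / stepSize m g i
      ≤ (6 * 2 ^ K) ^ 2 * (4 * ∑ k ∈ range m, edge g k) := by
    refine le_trans ?_ (mul_le_mul_of_nonneg_left (sum_stepSize_le m g) (by positivity))
    rw [mul_sum]
    refine sum_le_sum fun i hi => ?_
    have hi : i ≤ m := Nat.lt_succ_iff.1 (mem_range.1 hi)
    have h2 := h.dist_optimal_le hg hz hopt hi
    rw [← hK, dist_eq_norm] at h2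
    rw [hxg i hi, div_le_iff₀ (hτ i hi)]
    calc ‖g i - z i‖ ^ 2 ≤ (6 * 2 ^ K * stepSize m g i) ^ 2 := by
          unfold stepSize; gcongr
      _ = _ := by ring
  have h2 : ∑ j ∈ range m, 4 * (stepSize m g j + stepSize m g (j + 1))
      ≤ 32 * ∑ k ∈ range m, edge g k := by
    have e1 := sum_range_succ (stepSize m g) m
    have e2 := sum_range_succ' (stepSize m g) m
    rw [← mul_sum, sum_add_distrib]
    linarith [sum_stepSize_le m g, hτ m le_rfl, hτ 0 hm.le]
  have h3 := h.greedy_le hg hz hgr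
  rw [← hK] at h3
  have hO : 0 ≤ ∑ k ∈ range m, edge z k := sum_edge_nonneg z _
  have h4 : ∑ j ∈ range m, edge (fun i => (N : ℝ)⁻¹ • ∑ k ∈ range N, x (k + 1) i) j
      = (N : ℝ)⁻¹ * ∑ j ∈ range m,
        dist (∑ k ∈ range N, x (k + 1) j) (∑ k ∈ range N, x (k + 1) (j + 1)) := by
    rw [mul_sum]
    refine sum_congr rfl fun j _ => ?_
    rw [edge, dist_smul₀, Real.norm_of_nonneg (by positivity)]
  have hz' : ∑ j ∈ range m, dist (z j) (z (j + 1)) = ∑ k ∈ range m, edge z k := rfl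
  have hC : (touringConst (Module.finrank ℝ E) : ℝ)
      = (4 * (6 * 2 ^ K) ^ 2 + 32) * (8 * 4 ^ K + 1) := by
    simp [touringConst, hK]
  rw [h4, inv_mul_le_iff₀ hN']
  rw [hz'] at hrate
  -- The constant combines the primal term, the dual term and the greedy approximation factor.
  have h5 : (4 * (6 * 2 ^ K) ^ 2 + 32) * ∑ k ∈ range m, edge g k
      ≤ (N * ε) * ∑ k ∈ range m, edge z k := by
    refine (mul_le_mul_of_nonneg_left h3 (by positivity)).trans ?_
    rw [← mul_assoc, ← hC]
    exact mul_le_mul_of_nonneg_right hNε hO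
  linarith

end Guarantee

/-! ### Sequences with two ends -/

section Extend

/-- The entries `a, x₁, …, xₙ, b` as a sequence indexed by all natural numbers. -/
def extend {α : Type} {n : ℕ} (a b : α) (x : Fin n → α) (i : ℕ) : α :=
  if h : i < n + 2 then withEnds a b x ⟨i, h⟩ else b

variable {α : Type} {n : ℕ} (a b : α) (x : Fin n → α)

theorem withEnds_zero : withEnds a b x 0 = a := rfl

theorem withEnds_succ (i : Fin n) : withEnds a b x i.castSucc.succ = x i := by
  simp [withEnds]

theorem withEnds_last : withEnds a b x (Fin.last (n + 1)) = b := by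
  rw [← Fin.succ_last, withEnds, Fin.cons_succ, Fin.snoc_last]

@[simp] theorem extend_zero : extend a b x 0 = a := by
  simp only [extend, Nat.zero_lt_succ, dite_true]; rfl

@[simp] theorem extend_succ (i : Fin n) : extend a b x (i + 1) = x i := by
  have h : (i : ℕ) + 1 < n + 2 := by omega
  rw [extend, dif_pos h]
  exact withEnds_succ a b x i

@[simp] theorem extend_last : extend a b x (n + 1) = b := by
  rw [extend, dif_pos (by omega)]
  exact withEnds_last a b x

theorem extend_coe (i : Fin (n + 2)) : extend a b x i = withEnds a b x i := by
  rw [extend, dif_pos i.2]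

/-- Case distinction on the index of a sequence with ends. -/
theorem index_cases {n : ℕ} {p : ℕ → Prop} (h0 : p 0) (hs : ∀ i : Fin n, p (i + 1))
    (hl : p (n + 1)) : ∀ i ≤ n + 1, p i := by
  intro i hi
  rcases Nat.eq_zero_or_pos i with rfl | h
  · exact h0
  rcases hi.eq_or_lt with rfl | h'
  · exact hl
  · have := hs ⟨i - 1, by omega⟩
    rwa [Nat.sub_add_cancel h] at this

end Extend

/-! ### The iteration as a recursive sequence -/

section Iteration

variable {E : Type*} [NormedAddCommGroup E] [InnerProductSpace ℝ E]

/-- The path that always goes to the closest point of the next ball. -/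
noncomputable def greedy (c : ℕ → E) (r : ℕ → ℝ) : ℕ → E
  | 0 => c 0
  | i + 1 => ballProj (c (i + 1)) (r (i + 1)) (greedy c r i)

/-- The new points in one step of the primal-dual iteration. -/
noncomputable def nextPoint (c : ℕ → E) (r τ : ℕ → ℝ) (x u : ℕ → E) (i : ℕ) : E :=
  ballProj (c i) (r i) (x i - τ i • (u (i + 1) - u i))

/-- The new edge vectors in one step of the primal-dual iteration, given the extrapolated
points `y`. -/
noncomputable def nextDual (m : ℕ) (τ : ℕ → ℝ) (y u : ℕ → E) : ℕ → E
  | 0 => 0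
  | j + 1 => if j < m then ballProj 0 1 (u (j + 1)
      + (1 / (4 * (τ j + τ (j + 1)))) • (y j - y (j + 1))) else 0

/-- The primal-dual iteration: points and edge vectors. -/
noncomputable def pdIter (m : ℕ) (c : ℕ → E) (r τ : ℕ → ℝ) (g : ℕ → E) :
    ℕ → (ℕ → E) × (ℕ → E)
  | 0 => (g, 0)
  | k + 1 =>
    let x := (pdIter m c r τ g k).1
    let u := (pdIter m c r τ g k).2
    let x' := nextPoint c r τ x u
    (x', nextDual m τ (fun i => (2 : ℕ) • x' i - x i) u)

/-- The iteration that the algorithm performs. -/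
noncomputable def touringIter (m : ℕ) (c : ℕ → E) (r : ℕ → ℝ) : ℕ → (ℕ → E) × (ℕ → E) :=
  pdIter m c r (stepSize m (greedy c r)) (greedy c r)

end Iteration

/-! ### Tours as paths through balls, with the ends as balls of radius zero -/

section Tours

variable {d n : ℕ}

theorem tourLength_eq (start finish : Space d) (p : Fin n → Space d) :
    tourLength start finish p = ∑ k ∈ range (n + 1), edge (extend start finish p) k := by
  rw [tourLength, ← Fin.sum_univ_eq_sum_range (fun k => edge (extend start finish p) k)]
  refine sum_congr rfl fun i _ => ?_
  rw [edge, ← extend_coe, ← extend_coe]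
  rfl

theorem visits_extend_iff (start finish : Space d) (c : Fin n → Space d) (r : Fin n → ℝ)
    (p : Fin n → Space d) :
    Visits (n + 1) (extend start finish c) (extend 0 0 r) (extend start finish p) ↔
      IsTour (fun i => Metric.closedBall (c i) (r i)) p := by
  constructor
  · intro h i
    simpa using h (i + 1) (by omega)
  · intro h
    exact index_cases (by simp) (fun i => by simpa using h i) (by simp)

theorem Visits.eq_extend {start finish : Space d} {c : Fin n → Space d} {r : Fin n → ℝ}
    {y : ℕ → Space d} (h : Visits (n + 1) (extend start finish c) (extend 0 0 r) y) :
    ∀ i ≤ n + 1, extend start finish (fun i : Fin n => y (i + 1)) i = y i := by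
  refine index_cases ?_ (fun i => by simp) ?_
  · have := h 0 (Nat.zero_le _)
    simp only [extend_zero, Metric.closedBall_zero, Set.mem_singleton_iff] at this ⊢
    exact this.symm
  · have := h (n + 1) le_rfl
    simp only [extend_last, Metric.closedBall_zero, Set.mem_singleton_iff] at this ⊢
    exact this.symm

theorem Visits.tourLength_eq {start finish : Space d} {c : Fin n → Space d} {r : Fin n → ℝ}
    {y : ℕ → Space d} (h : Visits (n + 1) (extend start finish c) (extend 0 0 r) y) :
    tourLength start finish (fun i : Fin n => y (i + 1)) = ∑ k ∈ range (n + 1), edge y k := by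
  rw [_root_.tourLength_eq]
  refine sum_congr rfl fun k hk => ?_
  rw [mem_range] at hk
  rw [edge, edge, h.eq_extend k hk.le, h.eq_extend (k + 1) hk]

theorem continuous_tourLength (start finish : Space d) :
    Continuous (tourLength (n := n) start finish) := by
  have h : ∀ i : Fin (n + 2), Continuous fun p : Fin n → Space d => withEnds start finish p i := by
    intro i
    refine Fin.cases ?_ (fun i => Fin.lastCases ?_ (fun i => ?_) i) i
    · simpa only [withEnds_zero] using continuous_const
    · simpa only [Fin.succ_last, withEnds_last] using continuous_const
    · simpa only [withEnds_succ] using continuous_apply i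
  unfold tourLength
  exact continuous_finsetSum _ fun i _ => (h _).dist (h _)

theorem disjointBalls_extend {start finish : Space d} {c : Fin n → Space d} {r : Fin n → ℝ}
    (hr : ∀ i, 0 < r i)
    (h : DisjointRegions start finish (fun i => Metric.closedBall (c i) (r i))) :
    DisjointBalls (n + 1) (extend start finish c) (extend 0 0 r) where
  nonneg := index_cases (by simp) (fun i => by simpa using (hr i).le) (by simp)
  first := extend_zero _ _ _
  last := extend_last _ _ _
  disjoint := by
    have key : ∀ i ≤ n + 1, Metric.closedBall (extend start finish c i) (extend 0 0 r i)
        = extend {start} {finish} (fun i => Metric.closedBall (c i) (r i)) i :=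
      index_cases (by simp) (fun i => by simp) (by simp)
    intro i hi j hj hij
    rw [key i hi, key j hj]
    have := @h ⟨i, by omega⟩ ⟨j, by omega⟩ (by simpa using hij)
    simpa only [← extend_coe] using this

/-- Compactness. The splicing argument needs an actual minimiser as competitor. -/
theorem exists_shortest_tour (start finish : Space d) {c : Fin n → Space d} {r : Fin n → ℝ}
    (hr : ∀ i, 0 < r i) :
    ∃ z, IsTour (fun i => Metric.closedBall (c i) (r i)) z ∧
      ∀ x, IsTour (fun i => Metric.closedBall (c i) (r i)) x →
        tourLength start finish z ≤ tourLength start finish x := by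
  have hc : IsCompact (Set.univ.pi fun i => Metric.closedBall (c i) (r i)) :=
    isCompact_univ_pi fun i => isCompact_closedBall _ _
  obtain ⟨z, hz, hmin⟩ := hc.exists_isMinOn
    ⟨c, fun i _ => Metric.mem_closedBall_self (hr i).le⟩
    (continuous_tourLength start finish).continuousOn
  exact ⟨z, fun i => hz i (Set.mem_univ i), fun x hx => hmin fun i _ => hx i⟩

/-- The average of sufficiently many iterates is an approximate shortest tour. -/
theorem isApproxTour_average {start finish : Space d} {c : Fin n → Space d} {r : Fin n → ℝ}
    (hr : ∀ i, 0 < r i)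
    (h : DisjointRegions start finish (fun i => Metric.closedBall (c i) (r i)))
    {N : ℕ} {ε : ℝ} (hN : 0 < N) (hε : 0 ≤ ε) (hNε : (touringConst d : ℝ) ≤ N * ε) :
    IsApproxTour ε start finish (fun i => Metric.closedBall (c i) (r i)) (fun i => (N : ℝ)⁻¹ •
      ∑ k ∈ range N,
        (touringIter (n + 1) (extend start finish c) (extend 0 0 r) (k + 1)).1 (i + 1)) := by
  have hB := disjointBalls_extend hr h
  obtain ⟨z, hz, hmin⟩ := exists_shortest_tour start finish hr
  set cc := extend start finish c
  set rr := extend 0 0 r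
  set g := greedy cc rr with hg
  set I := touringIter (n + 1) cc rr with hI
  have hz' : Visits (n + 1) cc rr (extend start finish z) := (visits_extend_iff _ _ _ _ _).2 hz
  have havg := hB.average_le (Nat.succ_pos n) (g := g) rfl (fun i _ => rfl) hz'
    (fun y hy => by
      rw [← tourLength_eq, ← hy.tourLength_eq]
      refine hmin _ fun i => ?_
      simpa [cc, rr] using hy (i + 1) (by omega))
    (fun k => (I k).1) (fun k => (I k).2) (fun i _ => rfl)
    (fun k => by cases k <;> rfl)
    (fun k => by
      cases k with
      | zero => rfl
      | succ k => exact if_neg (lt_irrefl _))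
    rfl (fun k i _ => rfl)
    (fun k j hj => if_pos hj) hN (ε := ε) (by simpa using hNε)
  have hv := havg.1
  refine ⟨fun i => by simpa [cc, rr] using hv (i + 1) (by omega), fun x hx => ?_⟩
  have h1 := hv.tourLength_eq
  have h2 := havg.2
  rw [← h1, ← tourLength_eq] at h2
  refine h2.trans ?_
  exact mul_le_mul_of_nonneg_left (hmin x hx) (by linarith)

end Tours

/-! ### Implementation on the real RAM -/

namespace RealRAM

/-! ### Programs without loops -/

/-- The effect of a program without loops. -/
noncomputable def Prog.run : Prog → Store → Store
  | .skip, σ => σ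
  | .setNat x e, σ => { σ with natVar := Function.update σ.natVar x (e.eval σ) }
  | .setReal x e, σ => { σ with realVar := Function.update σ.realVar x (e.eval σ) }
  | .writeNat a i e, σ => { σ with natArr := writeCell σ.natArr a (i.eval σ) (e.eval σ) }
  | .writeReal a i e, σ => { σ with realArr := writeCell σ.realArr a (i.eval σ) (e.eval σ) }
  | .seq P Q, σ => Q.run (P.run σ)
  | .ite b P Q, σ => open Classical in if b.eval σ then P.run σ else Q.run σ
  | .loop _ _, σ => σ

/-- A bound on the running time of a program without loops. -/
def Prog.time : Prog → ℕ
  | .skip => 1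
  | .setNat _ e => e.cost + 1
  | .setReal _ e => e.cost + 1
  | .writeNat _ i e => i.cost + e.cost + 1
  | .writeReal _ i e => i.cost + e.cost + 1
  | .seq P Q => P.time + Q.time
  | .ite b P Q => b.cost + 1 + (P.time + Q.time)
  | .loop _ _ => 0

/-- The program has no loops. -/
def Prog.LoopFree : Prog → Prop
  | .seq P Q => P.LoopFree ∧ Q.LoopFree
  | .ite _ P Q => P.LoopFree ∧ Q.LoopFree
  | .loop _ _ => False
  | _ => True

/-- `P`, started in `σ`, halts after at most `T` steps in a state that satisfies `Q`. -/
def Runs (P : Prog) (σ : Store) (T : ℕ) (Q : Store → Prop) : Prop :=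
  ∃ t τ, Exec P σ t τ ∧ t ≤ T ∧ Q τ

theorem Prog.LoopFree.exec {P : Prog} (h : P.LoopFree) (σ : Store) :
    ∃ t ≤ P.time, Exec P σ t (P.run σ) := by
  induction P generalizing σ with
  | skip => exact ⟨_, le_rfl, .skip σ⟩
  | setNat x e => exact ⟨_, le_rfl, .setNat x e σ⟩
  | setReal x e => exact ⟨_, le_rfl, .setReal x e σ⟩
  | writeNat a i e => exact ⟨_, le_rfl, .writeNat a i e σ⟩
  | writeReal a i e => exact ⟨_, le_rfl, .writeReal a i e σ⟩
  | seq P Q ihP ihQ =>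
    obtain ⟨s, hs, h1⟩ := ihP h.1 σ
    obtain ⟨t, ht, h2⟩ := ihQ h.2 (P.run σ)
    exact ⟨s + t, Nat.add_le_add hs ht, .seq h1 h2⟩
  | ite b P Q ihP ihQ =>
    by_cases hb : b.eval σ
    · obtain ⟨t, ht, h1⟩ := ihP h.1 σ
      refine ⟨b.cost + 1 + t, by simp only [Prog.time]; omega, ?_⟩
      rw [Prog.run, if_pos hb]
      exact .iteTrue hb h1
    · obtain ⟨t, ht, h1⟩ := ihQ h.2 σ
      refine ⟨b.cost + 1 + t, by simp only [Prog.time]; omega, ?_⟩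
      rw [Prog.run, if_neg hb]
      exact .iteFalse hb h1
  | loop b P => exact h.elim

theorem Prog.LoopFree.runs {P : Prog} (h : P.LoopFree) {σ : Store} {Q : Store → Prop}
    (hQ : Q (P.run σ)) : Runs P σ P.time Q := by
  obtain ⟨t, ht, he⟩ := h.exec σ
  exact ⟨t, _, he, ht, hQ⟩

theorem Runs.mono {P : Prog} {σ : Store} {T T' : ℕ} {Q Q' : Store → Prop} (h : Runs P σ T Q)
    (hT : T ≤ T') (hQ : ∀ τ, Q τ → Q' τ) : Runs P σ T' Q' := by
  obtain ⟨t, τ, he, ht, hq⟩ := h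
  exact ⟨t, τ, he, ht.trans hT, hQ τ hq⟩

theorem Runs.seq {P P' : Prog} {σ : Store} {T T' : ℕ} {Q Q' : Store → Prop} (h : Runs P σ T Q)
    (h' : ∀ τ, Q τ → Runs P' τ T' Q') : Runs (.seq P P') σ (T + T') Q' := by
  obtain ⟨t, τ, he, ht, hq⟩ := h
  obtain ⟨t', τ', he', ht', hfin⟩ := h' τ hq
  exact ⟨t + t', τ', .seq he he', Nat.add_le_add ht ht', hfin⟩

/-- `σ` with the loop index changed to `v`. -/
def Store.setIndex (σ : Store) (v : ℕ) : Store :=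
  { σ with natVar := Function.update σ.natVar 1 v }

/-- Repeat `P` with natural variable `1` running through the natural numbers below `e`. -/
def forUp (e : NatExpr) (P : Prog) : Prog :=
  .seq (.setNat 1 (.const 0)) (.loop (.natLt (.var 1) e)
    (.seq P (.setNat 1 (.plus (.var 1) (.const 1)))))

/-- The invariant rule for counting loops. The invariant must ignore the index variable, which the
loop itself writes. The 7 covers the test and the increment, and the extra round in m + 1 pays for
initialisation and the final failing test. -/
theorem runs_forUp {e : NatExpr} {P : Prog} {m : ℕ} {I : ℕ → Store → Prop} (hP : P.LoopFree)
    (hm : ∀ k σ, I k σ → e.eval σ = m)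
    (hstep : ∀ k < m, ∀ σ, I k σ → σ.natVar 1 = k → I (k + 1) (P.run σ))
    (hvar : ∀ σ, (P.run σ).natVar = σ.natVar)
    (hidx : ∀ k σ v, I k σ → I k (σ.setIndex v)) {σ : Store} (h0 : I 0 σ) :
    Runs (forUp e P) σ ((m + 1) * (e.cost + P.time + 7)) (I m) := by
  have key : ∀ l k, k + l = m → ∀ σ, I k σ → σ.natVar 1 = k →
      Runs (.loop (.natLt (.var 1) e) (.seq P (.setNat 1 (.plus (.var 1) (.const 1))))) σ
        (l * (e.cost + P.time + 7) + (e.cost + 3)) (I m) := by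
    intro l
    induction l with
    | zero =>
      intro k hk σ hI hσ
      obtain rfl : k = m := hk
      refine ⟨_, σ, .loopFalse ?_, ?_, hI⟩
      · simp [Test.eval, NatExpr.eval, hm k σ hI, hσ]
      · simp only [Test.cost, NatExpr.cost]; omega
    | succ l ih =>
      intro k hk σ hI hσ
      obtain ⟨t, ht, he⟩ := hP.exec σ
      have hI' := hstep k (by omega) σ hI hσ
      have hv : (P.run σ).natVar 1 + 1 = k + 1 := by rw [hvar, hσ]
      obtain ⟨t', τ, he', ht', hQ⟩ := ih (k + 1) (by omega)
        ((P.run σ).setIndex ((P.run σ).natVar 1 + 1)) (hidx _ _ _ hI') (by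
          simp [Store.setIndex, hv])
      refine ⟨_, τ, .loopTrue ?_ (.seq he (.setNat _ _ _)) he', ?_, hQ⟩
      · simp only [Test.eval, NatExpr.eval, hm k σ hI, hσ]; omega
      · simp only [Test.cost, NatExpr.cost]
        have : (l + 1) * (e.cost + P.time + 7)
          = l * (e.cost + P.time + 7) + (e.cost + P.time + 7) := by ring
        omega
  obtain ⟨t, τ, he, ht, hQ⟩ := key m 0 (Nat.zero_add m) (σ.setIndex 0) (hidx _ _ _ h0)
    (by simp [Store.setIndex])
  refine ⟨_, τ, .seq (.setNat _ _ _) he, ?_, hQ⟩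
  simp only [NatExpr.cost]
  have : (m + 1) * (e.cost + P.time + 7) = m * (e.cost + P.time + 7) + (e.cost + P.time + 7) := by
    ring
  omega

/-! ### Vectors in memory

Coordinate `j` of the `i`-th vector of field `F < 16` is kept in cell `i` of array `16 * j + F`. -/

/-- The `i`-th vector of field `F`. -/
noncomputable def vec (d : ℕ) (σ : Store) (F i : ℕ) : Space d :=
  WithLp.toLp 2 fun j : Fin d => σ.realArr (16 * j + F) i

theorem vec_apply (d : ℕ) (σ : Store) (F i : ℕ) (j : Fin d) :
    vec d σ F i j = σ.realArr (16 * j + F) i := rfl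

/-- `σ` with the first `m` coordinates of the `i`-th vector of field `F` changed to `f`. -/
noncomputable def Store.vwrite (σ : Store) (F i m : ℕ) (f : ℕ → ℝ) : Store :=
  { σ with realArr := fun a k => if k = i ∧ a % 16 = F ∧ a / 16 < m then f (a / 16)
      else σ.realArr a k }

/-- `σ` with the `i`-th vector of field `F` changed to `v`. -/
noncomputable def Store.vstore {d : ℕ} (σ : Store) (F i : ℕ) (v : Space d) : Store :=
  σ.vwrite F i d fun j => if h : j < d then v ⟨j, h⟩ else 0

@[simp] theorem natVar_vwrite (σ : Store) (F i m : ℕ) (f : ℕ → ℝ) :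
    (σ.vwrite F i m f).natVar = σ.natVar := rfl

@[simp] theorem realVar_vwrite (σ : Store) (F i m : ℕ) (f : ℕ → ℝ) :
    (σ.vwrite F i m f).realVar = σ.realVar := rfl

@[simp] theorem natVar_vstore {d : ℕ} (σ : Store) (F i : ℕ) (v : Space d) :
    (σ.vstore F i v).natVar = σ.natVar := rfl

theorem realArr_vwrite_of_le (σ : Store) (F i : ℕ) (f : ℕ → ℝ) {G j m : ℕ} (hG : G < 16)
    (h : m ≤ j) (k : ℕ) : (σ.vwrite F i m f).realArr (16 * j + G) k = σ.realArr (16 * j + G) k := by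
  have h1 : (16 * j + G) / 16 = j := by omega
  simp [Store.vwrite, h1, h.not_gt]

theorem realArr_vwrite_of_ne (σ : Store) (F i m : ℕ) (f : ℕ → ℝ) {a : ℕ} (h : a % 16 ≠ F) :
    (σ.vwrite F i m f).realArr a = σ.realArr a := by
  funext k
  simp [Store.vwrite, h]

theorem realArr_vstore_of_ne {d : ℕ} (σ : Store) (F i : ℕ) (v : Space d) {a : ℕ}
    (h : a % 16 ≠ F) : (σ.vstore F i v).realArr a = σ.realArr a :=
  realArr_vwrite_of_ne _ _ _ _ _ h

theorem vec_vstore_self {d : ℕ} (σ : Store) {F : ℕ} (hF : F < 16) (i : ℕ) (v : Space d) :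
    vec d (σ.vstore F i v) F = Function.update (vec d σ F) i v := by
  funext k
  ext j
  have h1 : (16 * (j : ℕ) + F) / 16 = j := by omega
  have h2 : (16 * (j : ℕ) + F) % 16 = F := by omega
  rw [vec_apply]
  rcases eq_or_ne k i with rfl | h
  · simp [Store.vstore, Store.vwrite, h1, h2]
  · simp [Store.vstore, Store.vwrite, h, vec_apply]

theorem vec_vstore_of_ne {d : ℕ} (σ : Store) {F G : ℕ} (hG : G < 16) (h : G ≠ F) (i : ℕ)
    (v : Space d) : vec d (σ.vstore F i v) G = vec d σ G := by
  funext k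
  ext j
  rw [vec_apply, vec_apply, realArr_vstore_of_ne]
  omega

/-- `τ` differs from `σ` at most in the arrays of the fields in `Fs` and in variables other than
natural variable `0` and real variables `0` and `3`. -/
structure Agree (Fs : Finset ℕ) (σ τ : Store) : Prop where
  natVar : τ.natVar 0 = σ.natVar 0
  realVar_zero : τ.realVar 0 = σ.realVar 0
  realVar_three : τ.realVar 3 = σ.realVar 3
  realArr : ∀ a, a % 16 ∉ Fs → τ.realArr a = σ.realArr a

theorem Agree.refl (Fs : Finset ℕ) (σ : Store) : Agree Fs σ σ := ⟨rfl, rfl, rfl, fun _ _ => rfl⟩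

theorem Agree.trans {Fs : Finset ℕ} {σ τ υ : Store} (h : Agree Fs σ τ) (h' : Agree Fs τ υ) :
    Agree Fs σ υ :=
  ⟨h'.1.trans h.1, h'.2.trans h.2, h'.3.trans h.3, fun a ha => (h'.4 a ha).trans (h.4 a ha)⟩

theorem Agree.setIndex {Fs : Finset ℕ} {σ τ : Store} (h : Agree Fs σ τ) (v : ℕ) :
    Agree Fs σ (τ.setIndex v) :=
  ⟨by simpa [Store.setIndex] using h.1, h.2, h.3, h.4⟩

theorem Agree.vec {Fs : Finset ℕ} {σ τ : Store} (h : Agree Fs σ τ) (d : ℕ) {F : ℕ} (hF : F < 16)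
    (hFs : F ∉ Fs) : vec d τ F = vec d σ F := by
  funext i
  ext j
  rw [vec_apply, vec_apply, h.realArr]
  have : (16 * (j : ℕ) + F) % 16 = F := by omega
  rwa [this]

theorem Agree.vstore {Fs : Finset ℕ} {σ τ : Store} (h : Agree Fs σ τ) {d F : ℕ} (hF : F ∈ Fs)
    (i : ℕ) (v : Space d) : Agree Fs σ (τ.vstore F i v) :=
  ⟨h.1, h.2, h.3, fun a ha => by
    rw [realArr_vstore_of_ne _ _ _ _ fun e => ha (e ▸ hF), h.4 a ha]⟩

/-! ### Vector instructions -/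

/-- Write the numbers `e 0, …, e (d - 1)` into the vector of field `F` with index `i`. -/
def vset (F : ℕ) (i : NatExpr) (e : ℕ → RealExpr) : ℕ → Prog
  | 0 => .skip
  | j + 1 => .seq (vset F i e j) (.writeReal (16 * j + F) i (e j))

theorem loopFree_vset (F : ℕ) (i : NatExpr) (e : ℕ → RealExpr) (d : ℕ) :
    (vset F i e d).LoopFree := by
  induction d with
  | zero => trivial
  | succ d ih => exact ⟨ih, trivial⟩

/-- The last hypothesis asks only that the j-th expression ignore writes to coordinates below j. A
vector may thus be updated in place from its own coordinates. -/
theorem run_vset {d F : ℕ} {i : NatExpr} {e : ℕ → RealExpr} {σ : Store} (v : Space d)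
    (hF : F < 16) (hv : ∀ j : Fin d, (e j).eval σ = v j)
    (hi : ∀ τ : Store, τ.natVar = σ.natVar → i.eval τ = i.eval σ)
    (he : ∀ j m, m ≤ j → ∀ f, (e j).eval (σ.vwrite F (i.eval σ) m f) = (e j).eval σ) :
    (vset F i e d).run σ = σ.vstore F (i.eval σ) v := by
  have key : ∀ m, (vset F i e m).run σ = σ.vwrite F (i.eval σ) m fun j => (e j).eval σ := by
    intro m
    induction m with
    | zero => simp [vset, Prog.run, Store.vwrite]
    | succ m ih =>
      have hi' := hi (σ.vwrite F (i.eval σ) m fun j => (e j).eval σ) rfl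
      rw [vset, Prog.run, ih, Prog.run, he m m le_rfl, hi']
      simp only [Store.vwrite, Store.mk.injEq, true_and]
      funext a k
      by_cases ha : a = 16 * m + F
      · have h1 : a % 16 = F := by omega
        have h2 : a / 16 = m := by omega
        subst ha
        by_cases hk : k = i.eval σ
        · simp [writeCell, hk, h1, h2]
        · simp [writeCell, hk]
      · have h1 : (a % 16 = F ∧ a / 16 ≤ m) ↔ (a % 16 = F ∧ a / 16 < m) := by omega
        simp [writeCell, ha, h1]
  rw [key, Store.vstore]
  simp only [Store.vwrite, Store.mk.injEq, true_and]
  funext a k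
  by_cases h : a / 16 < d
  · simp only [h, and_true, dite_true]
    rw [← hv ⟨a / 16, h⟩]
  · simp [h]

/-- The sum of `e 0, …, e (d - 1)`. -/
def sumExpr (e : ℕ → RealExpr) : ℕ → RealExpr
  | 0 => .const 0
  | j + 1 => .plus (sumExpr e j) (e j)

theorem eval_sumExpr (e : ℕ → RealExpr) (d : ℕ) (σ : Store) :
    (sumExpr e d).eval σ = ∑ j : Fin d, (e j).eval σ := by
  rw [Fin.sum_univ_eq_sum_range (fun j => (e j).eval σ)]
  induction d with
  | zero => simp [sumExpr, RealExpr.eval]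
  | succ d ih => rw [sum_range_succ, ← ih, sumExpr, RealExpr.eval]

/-- The distance of the vectors with the coordinates `e j` and `f j`. -/
def distExpr (e f : ℕ → RealExpr) (d : ℕ) : RealExpr :=
  .sqrt (sumExpr (fun j => .times (.minus (e j) (f j)) (.minus (e j) (f j))) d)

theorem eval_distExpr {d : ℕ} {e f : ℕ → RealExpr} {σ : Store} {v w : Space d}
    (hv : ∀ j : Fin d, (e j).eval σ = v j) (hw : ∀ j : Fin d, (f j).eval σ = w j) :
    (distExpr e f d).eval σ = dist v w := by
  rw [distExpr, RealExpr.eval, eval_sumExpr, EuclideanSpace.dist_eq]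
  congr 1
  refine sum_congr rfl fun j _ => ?_
  rw [RealExpr.eval, RealExpr.eval, hv, hw, Real.dist_eq, sq_abs, sq]

/-- Coordinate `j` of the `i`-th vector of field `F`. -/
def coord (F : ℕ) (i : NatExpr) (j : ℕ) : RealExpr := .read (16 * j + F) i

theorem eval_coord {d : ℕ} (F : ℕ) (i : NatExpr) (j : Fin d) (σ : Store) :
    (coord F i j).eval σ = vec d σ F (i.eval σ) j := rfl

/-- Replace the `i`-th vector of field `F` by its projection to the ball with centre `c` and
radius `r`. -/
def projectProg (d F : ℕ) (i : NatExpr) (c : ℕ → RealExpr) (r : RealExpr) : Prog :=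
  .seq (.setReal 1 (distExpr (coord F i) c d))
    (.seq (.ite (.realLt (.var 1) r) (.setReal 2 (.const 1)) (.setReal 2 (.div r (.var 1))))
      (vset F i (fun j => .plus (c j) (.times (.var 2) (.minus (coord F i j) (c j)))) d))

theorem loopFree_projectProg (d F : ℕ) (i : NatExpr) (c : ℕ → RealExpr) (r : RealExpr) :
    (projectProg d F i c r).LoopFree :=
  ⟨trivial, ⟨trivial, trivial⟩, loopFree_vset _ _ _ _⟩

/-- The function f hides the scratch values in real variables 1 and 2; only variables 0 and 3, the
accuracy and the iteration count, have to survive. -/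
theorem run_projectProg {d F : ℕ} {i : NatExpr} {c : ℕ → RealExpr} {r : RealExpr} {σ : Store}
    {ctr : Space d} {rad : ℝ} (hF : F < 16)
    (hi : ∀ τ : Store, τ.natVar = σ.natVar → i.eval τ = i.eval σ)
    (hc : ∀ τ : Store, τ.natVar = σ.natVar → (∀ a, a % 16 ≠ F → τ.realArr a = σ.realArr a) →
      ∀ j : ℕ, (c j).eval τ = (c j).eval σ)
    (hctr : ∀ j : Fin d, (c j).eval σ = ctr j)
    (hr : ∀ τ : Store, τ.natVar = σ.natVar → (∀ a, a % 16 ≠ F → τ.realArr a = σ.realArr a) →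
      r.eval τ = rad) :
    ∃ f : ℕ → ℝ, f 0 = σ.realVar 0 ∧ f 3 = σ.realVar 3 ∧
      (projectProg d F i c r).run σ = ({ σ with realVar := f } : Store).vstore F (i.eval σ)
        (ballProj ctr rad (vec d σ F (i.eval σ))) := by
  have hdist : (distExpr (coord F i) c d).eval σ = ‖vec d σ F (i.eval σ) - ctr‖ := by
    rw [← dist_eq_norm]
    exact eval_distExpr (fun j => rfl) hctr
  set σ₁ : Store := { σ with
    realVar := Function.update σ.realVar 1 ‖vec d σ F (i.eval σ) - ctr‖ } with hσ₁
  have hr1 := hr σ₁ rfl fun _ _ => rfl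
  set f : ℕ → ℝ := Function.update σ₁.realVar 2 (
    if ‖vec d σ F (i.eval σ) - ctr‖ < rad then (1 : ℝ)
    else rad / ‖vec d σ F (i.eval σ) - ctr‖) with hf
  refine ⟨f, by simp [hf, hσ₁], by simp [hf, hσ₁], ?_⟩
  have hrun : (Prog.ite (.realLt (.var 1) r) (.setReal 2 (.const 1))
      (.setReal 2 (.div r (.var 1)))).run σ₁ = { σ with realVar := f } := by
    simp only [Prog.run, Test.eval, RealExpr.eval, hr1, hf]
    have h1 : σ₁.realVar 1 = ‖vec d σ F (i.eval σ) - ctr‖ := by simp [hσ₁]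
    rw [h1]
    split_ifs <;> simp [hσ₁]
  rw [projectProg, Prog.run, Prog.run, Prog.run, hdist, ← hσ₁, hrun]
  have hi' : i.eval ({ σ with realVar := f } : Store) = i.eval σ := hi _ rfl
  have hc' : ∀ j, (c j).eval ({ σ with realVar := f } : Store) = (c j).eval σ :=
    hc _ rfl fun _ _ => rfl
  rw [run_vset (ballProj ctr rad (vec d σ F (i.eval σ))) hF, hi']
  · intro j
    simp only [RealExpr.eval, hc', hctr, eval_coord, hi']
    have h2 : f 2 = if ‖vec d σ F (i.eval σ) - ctr‖ < rad then (1 : ℝ)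
      else rad / ‖vec d σ F (i.eval σ) - ctr‖ := by simp [hf]
    rw [h2]
    rfl
  · intro τ hτ
    rw [hi', hi τ hτ]
  · intro j m hm g
    have e2 : i.eval ((Store.mk σ.natVar f σ.natArr σ.realArr).vwrite F (i.eval σ) m g)
        = i.eval σ :=
      hi _ rfl
    have e3 : (c j).eval ((Store.mk σ.natVar f σ.natArr σ.realArr).vwrite F (i.eval σ) m g)
        = (c j).eval σ :=
      hc (Store.vwrite { σ with realVar := f } F (i.eval σ) m g) rfl
        (fun a ha => realArr_vwrite_of_ne _ _ _ _ _ ha) j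
    rw [hi']
    simp only [RealExpr.eval, coord, hi', e2, e3, hc', realVar_vwrite]
    rw [realArr_vwrite_of_le _ _ _ _ hF hm]

/-! ### Scalars in memory -/

/-- `σ` with cell `i` of the real array `F` changed to `v`. -/
noncomputable def Store.sstore (σ : Store) (F i : ℕ) (v : ℝ) : Store :=
  { σ with realArr := writeCell σ.realArr F i v }

@[simp] theorem natVar_sstore (σ : Store) (F i : ℕ) (v : ℝ) :
    (σ.sstore F i v).natVar = σ.natVar := rfl

theorem realArr_sstore_self (σ : Store) (F i : ℕ) (v : ℝ) :
    (σ.sstore F i v).realArr F = Function.update (σ.realArr F) i v := by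
  simp [Store.sstore, writeCell]

theorem realArr_sstore_of_ne (σ : Store) (F i : ℕ) (v : ℝ) {a : ℕ} (h : a ≠ F) :
    (σ.sstore F i v).realArr a = σ.realArr a := by
  simp [Store.sstore, writeCell, h]

theorem vec_sstore_of_ne (d : ℕ) (σ : Store) {F G : ℕ} (hF : F < 16) (hG : G < 16) (h : G ≠ F)
    (i : ℕ) (v : ℝ) : vec d (σ.sstore F i v) G = vec d σ G := by
  funext k
  ext j
  rw [vec_apply, vec_apply, realArr_sstore_of_ne]
  omega

theorem Agree.sstore {Fs : Finset ℕ} {σ τ : Store} (h : Agree Fs σ τ) {F : ℕ} (hF : F ∈ Fs)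
    (hF' : F < 16) (i : ℕ) (v : ℝ) : Agree Fs σ (τ.sstore F i v) :=
  ⟨h.1, h.2, h.3, fun a ha => by
    rw [realArr_sstore_of_ne, h.4 a ha]
    rintro rfl
    exact ha (by rwa [Nat.mod_eq_of_lt hF'])⟩

theorem Agree.realArr_lt {Fs : Finset ℕ} {σ τ : Store} (h : Agree Fs σ τ) {F : ℕ} (hF : F < 16)
    (hFs : F ∉ Fs) : τ.realArr F = σ.realArr F :=
  h.realArr F (by rwa [Nat.mod_eq_of_lt hF])

theorem Agree.setRealVar {Fs : Finset ℕ} {σ τ : Store} (h : Agree Fs σ τ) {f : ℕ → ℝ}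
    (h0 : f 0 = τ.realVar 0) (h3 : f 3 = τ.realVar 3) : Agree Fs σ { τ with realVar := f } :=
  ⟨h.1, h0.trans h.2, h3.trans h.3, h.4⟩

@[simp] theorem vec_setRealVar (d : ℕ) (σ : Store) (f : ℕ → ℝ) :
    vec d { σ with realVar := f } = vec d σ := rfl

theorem eval_coord_vwrite {G j m : ℕ} (h : m ≤ j) (σ : Store) (F i : ℕ) (f : ℕ → ℝ) {e : NatExpr}
    (hG : G < 16) (he : e.eval (σ.vwrite F i m f) = e.eval σ) :
    (coord G e j).eval (σ.vwrite F i m f) = (coord G e j).eval σ := by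
  rw [coord, RealExpr.eval, RealExpr.eval, he, realArr_vwrite_of_le _ _ _ _ hG h]

/-- Extends by one entry an invariant of the form "new values where P holds, old values elsewhere".
-/
theorem update_ite {α : Type*} {P Q : ℕ → Prop} [DecidablePred P] [DecidablePred Q]
    {f g : ℕ → α} {p : ℕ} (h : ∀ i, Q i ↔ P i ∨ i = p) :
    Function.update (fun i => if P i then f i else g i) p (f p)
      = fun i => if Q i then f i else g i := by
  funext i
  rcases eq_or_ne i p with rfl | hi
  · simp [(h i).2 (Or.inr rfl)]
  · simp [hi, h i]

/-! ### The program

Fields `5` and `6` hold the centres and the radii of the balls, with the two ends as first and last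
ball, `7` the points, `8` the extrapolated points, `9` scratch vectors, `10` the edge vectors, `11`
the sums of the points over all iterations, `12` and `13` the smoothed edge lengths from the left
and from the right, `14` the edge lengths of the greedy path. -/

/-- The loop index. -/
def idx : NatExpr := .var 1

/-- The loop index plus one. -/
def idxSucc : NatExpr := .plus (.var 1) (.const 1)

@[simp] theorem eval_idx (σ : Store) : idx.eval σ = σ.natVar 1 := rfl

@[simp] theorem eval_idxSucc (σ : Store) : idxSucc.eval σ = σ.natVar 1 + 1 := rfl

theorem eval_idx_vwrite {G j m : ℕ} (h : m ≤ j) (σ : Store) (F i : ℕ) (f : ℕ → ℝ)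
    (hG : G < 16) : (coord G idx j).eval (σ.vwrite F i m f) = (coord G idx j).eval σ :=
  eval_coord_vwrite h σ F i f hG rfl

theorem eval_idxSucc_vwrite {G j m : ℕ} (h : m ≤ j) (σ : Store) (F i : ℕ) (f : ℕ → ℝ)
    (hG : G < 16) : (coord G idxSucc j).eval (σ.vwrite F i m f) = (coord G idxSucc j).eval σ :=
  eval_coord_vwrite h σ F i f hG rfl

/-- Update of one point. -/
def pointBody (d : ℕ) : Prog :=
  .seq (vset 9 idx (fun j => .minus (coord 7 idx j) (.times (.plus (.read 12 idx) (.read 13 idx))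
      (.minus (coord 10 idxSucc j) (coord 10 idx j)))) d)
    (.seq (projectProg d 9 idx (coord 5 idx) (.read 6 idx))
      (.seq (vset 8 idx (fun j => .minus (.plus (coord 9 idx j) (coord 9 idx j)) (coord 7 idx j)) d)
        (.seq (vset 7 idx (coord 9 idx) d)
          (vset 11 idx (fun j => .plus (coord 11 idx j) (coord 9 idx j)) d))))

theorem loopFree_pointBody (d : ℕ) : (pointBody d).LoopFree :=
  ⟨loopFree_vset _ _ _ _, loopFree_projectProg _ _ _ _ _, loopFree_vset _ _ _ _,
    loopFree_vset _ _ _ _, loopFree_vset _ _ _ _⟩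

/-- The point that `pointBody` computes. -/
noncomputable def newPoint (d : ℕ) (σ : Store) (i : ℕ) : Space d :=
  ballProj (vec d σ 5 i) (σ.realArr 6 i) (vec d σ 7 i
    - (σ.realArr 12 i + σ.realArr 13 i) • (vec d σ 10 (i + 1) - vec d σ 10 i))

theorem run_pointBody (d : ℕ) (σ : Store) :
    ((pointBody d).run σ).natVar = σ.natVar ∧ Agree {7, 8, 9, 11} σ ((pointBody d).run σ) ∧
    vec d ((pointBody d).run σ) 7
      = Function.update (vec d σ 7) (σ.natVar 1) (newPoint d σ (σ.natVar 1)) ∧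
    vec d ((pointBody d).run σ) 8 = Function.update (vec d σ 8) (σ.natVar 1)
      ((2 : ℕ) • newPoint d σ (σ.natVar 1) - vec d σ 7 (σ.natVar 1)) ∧
    vec d ((pointBody d).run σ) 11 = Function.update (vec d σ 11) (σ.natVar 1)
      (vec d σ 11 (σ.natVar 1) + newPoint d σ (σ.natVar 1)) := by
  simp only [pointBody, Prog.run]
  set i := σ.natVar 1 with hi
  set q := vec d σ 7 i - (σ.realArr 12 i + σ.realArr 13 i) • (vec d σ 10 (i + 1) - vec d σ 10 i)
    with hq
  rw [run_vset (σ := σ) q (by norm_num) (fun j => by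
      simp [RealExpr.eval, eval_coord, hq, ← hi])
    (fun τ hτ => by simp [hτ])
    (fun j m hm f => by
      simp [RealExpr.eval, eval_idx_vwrite hm, eval_idxSucc_vwrite hm, realArr_vwrite_of_ne])]
  set σ₁ := σ.vstore 9 (idx.eval σ) q with hσ₁
  have hi₁ : σ₁.natVar 1 = i := rfl
  obtain ⟨f, hf0, hf3, hrun⟩ := run_projectProg (d := d) (F := 9) (i := idx) (c := coord 5 idx)
    (r := .read 6 idx) (σ := σ₁) (ctr := vec d σ 5 i) (rad := σ.realArr 6 i) (by norm_num)
    (fun τ hτ => by simp [hτ])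
    (fun τ hτ ha j => by
      simp only [coord, RealExpr.eval, eval_idx, hτ]
      rw [ha _ (by omega)])
    (fun j => by
      rw [eval_coord, hσ₁, vec_vstore_of_ne _ (by norm_num) (by norm_num)]; rfl)
    (fun τ hτ ha => by
      simp only [RealExpr.eval, eval_idx, hτ]
      rw [ha _ (by norm_num), hσ₁, realArr_vstore_of_ne _ _ _ _ (by norm_num), ← hσ₁, hi₁])
  have hp : ballProj (vec d σ 5 i) (σ.realArr 6 i) (vec d σ₁ 9 (idx.eval σ₁)) = newPoint d σ i := by
    rw [hσ₁, vec_vstore_self _ (by norm_num)]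
    simp [newPoint, hq, ← hi]
  rw [hrun, hp]
  set p := newPoint d σ i
  set σ₂ := ({ σ₁ with realVar := f } : Store).vstore 9 (idx.eval σ₁) p with hσ₂
  have hi₂ : σ₂.natVar 1 = i := rfl
  have h29 : vec d σ₂ 9 i = p := by
    rw [hσ₂, vec_vstore_self _ (by norm_num)]; simp [hi₁]
  have h2 : ∀ G, G < 16 → G ≠ 9 → vec d σ₂ G = vec d σ G := fun G hG hG' => by
    rw [hσ₂, vec_vstore_of_ne _ hG hG', vec_setRealVar, hσ₁, vec_vstore_of_ne _ hG hG']
  -- The extrapolation reads the old point, so it precedes the overwriting of field 7.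
  rw [run_vset (σ := σ₂) ((2 : ℕ) • p - vec d σ 7 i) (by norm_num) (fun j => by
      simp [RealExpr.eval, eval_coord, hi₂, h29, h2, two_smul])
    (fun τ hτ => by simp [hτ])
    (fun j m hm f => by simp [RealExpr.eval, eval_idx_vwrite hm])]
  set σ₃ := σ₂.vstore 8 (idx.eval σ₂) ((2 : ℕ) • p - vec d σ 7 i) with hσ₃
  have hi₃ : σ₃.natVar 1 = i := rfl
  have h3 : ∀ G, G < 16 → G ≠ 8 → vec d σ₃ G = vec d σ₂ G := fun G hG hG' => by
    rw [hσ₃, vec_vstore_of_ne _ hG hG']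
  rw [run_vset (σ := σ₃) p (by norm_num) (fun j => by
      simp [eval_coord, hi₃, h3, h29])
    (fun τ hτ => by simp [hτ])
    (fun j m hm f => by simp [eval_idx_vwrite hm])]
  set σ₄ := σ₃.vstore 7 (idx.eval σ₃) p with hσ₄
  have hi₄ : σ₄.natVar 1 = i := rfl
  have h4 : ∀ G, G < 16 → G ≠ 7 → vec d σ₄ G = vec d σ₃ G := fun G hG hG' => by
    rw [hσ₄, vec_vstore_of_ne _ hG hG']
  rw [run_vset (σ := σ₄) (vec d σ 11 i + p) (by norm_num) (fun j => by
      simp [RealExpr.eval, eval_coord, hi₄, h4, h3, h29, h2])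
    (fun τ hτ => by simp [hτ])
    (fun j m hm f => by simp [RealExpr.eval, eval_idx_vwrite hm])]
  refine ⟨rfl, ?_, ?_, ?_, ?_⟩
  · exact (((((Agree.refl _ σ).vstore (by simp) _ _).setRealVar hf0 hf3).vstore (by simp)
      _ _).vstore (by simp) _ _).vstore (by simp) _ _ |>.vstore (by simp) _ _
  · rw [vec_vstore_of_ne _ (by norm_num) (by norm_num), hσ₄, vec_vstore_self _ (by norm_num),
      eval_idx, hi₃, h3 7 (by norm_num) (by norm_num), h2 7 (by norm_num) (by norm_num)]
  · rw [vec_vstore_of_ne _ (by norm_num) (by norm_num), h4 8 (by norm_num) (by norm_num), hσ₃,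
      vec_vstore_self _ (by norm_num), eval_idx, hi₂, h2 8 (by norm_num) (by norm_num)]
  · rw [vec_vstore_self _ (by norm_num), eval_idx, hi₄, h4 11 (by norm_num) (by norm_num),
      h3 11 (by norm_num) (by norm_num), h2 11 (by norm_num) (by norm_num)]

/-- Update of one edge vector. -/
def dualBody (d : ℕ) : Prog :=
  .seq (vset 10 idxSucc (fun j => .plus (coord 10 idxSucc j) (.times (.div (.const 1)
      (.times (.const 4) (.plus (.plus (.read 12 idx) (.read 13 idx))
        (.plus (.read 12 idxSucc) (.read 13 idxSucc)))))
      (.minus (coord 8 idx j) (coord 8 idxSucc j)))) d)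
    (projectProg d 10 idxSucc (fun _ => .const 0) (.const 1))

theorem loopFree_dualBody (d : ℕ) : (dualBody d).LoopFree :=
  ⟨loopFree_vset _ _ _ _, loopFree_projectProg _ _ _ _ _⟩

/-- The edge vector that `dualBody` computes. -/
noncomputable def newDual (d : ℕ) (σ : Store) (i : ℕ) : Space d :=
  ballProj 0 1 (vec d σ 10 (i + 1) + (1 / (4 * ((σ.realArr 12 i + σ.realArr 13 i)
    + (σ.realArr 12 (i + 1) + σ.realArr 13 (i + 1))))) • (vec d σ 8 i - vec d σ 8 (i + 1)))

theorem run_dualBody (d : ℕ) (σ : Store) :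
    ((dualBody d).run σ).natVar = σ.natVar ∧ Agree {10} σ ((dualBody d).run σ) ∧
    vec d ((dualBody d).run σ) 10
      = Function.update (vec d σ 10) (σ.natVar 1 + 1) (newDual d σ (σ.natVar 1)) := by
  simp only [dualBody, Prog.run]
  set i := σ.natVar 1 with hi
  set q := vec d σ 10 (i + 1) + (1 / (4 * ((σ.realArr 12 i + σ.realArr 13 i)
    + (σ.realArr 12 (i + 1) + σ.realArr 13 (i + 1))))) • (vec d σ 8 i - vec d σ 8 (i + 1)) with hq
  rw [run_vset (σ := σ) q (by norm_num) (fun j => by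
      simp [RealExpr.eval, eval_coord, hq, ← hi])
    (fun τ hτ => by simp [hτ])
    (fun j m hm f => by
      simp [RealExpr.eval, eval_idx_vwrite hm, eval_idxSucc_vwrite hm, realArr_vwrite_of_ne])]
  set σ₁ := σ.vstore 10 (idxSucc.eval σ) q with hσ₁
  have hi₁ : σ₁.natVar 1 = i := rfl
  obtain ⟨f, hf0, hf3, hrun⟩ := run_projectProg (d := d) (F := 10) (i := idxSucc)
    (c := fun _ => .const 0) (r := .const 1) (σ := σ₁) (ctr := 0) (rad := 1) (by norm_num)
    (fun τ hτ => by simp [hτ]) (fun τ hτ ha j => rfl) (fun j => by simp [RealExpr.eval])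
    (fun τ hτ ha => by simp [RealExpr.eval])
  have hp : ballProj 0 1 (vec d σ₁ 10 (idxSucc.eval σ₁)) = newDual d σ i := by
    rw [hσ₁, vec_vstore_self _ (by norm_num)]
    simp [newDual, hq, ← hi]
  rw [hrun, hp]
  refine ⟨rfl, ((Agree.refl _ σ).vstore (by simp) _ _).setRealVar hf0 hf3 |>.vstore (by simp) _ _,
    ?_⟩
  rw [vec_vstore_self _ (by norm_num), vec_setRealVar, hσ₁, vec_vstore_self _ (by norm_num)]
  simp [← hi]

/-- The number of balls plus `k`. -/
def sizePlus (k : ℕ) : NatExpr := .plus (.var 0) (.const k)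

@[simp] theorem eval_sizePlus (k : ℕ) (σ : Store) : (sizePlus k).eval σ = σ.natVar 0 + k := rfl

/-- A new point depends on no other vertex's point, so the in-place sweep equals the simultaneous
update. -/
theorem newPoint_congr {d : ℕ} {σ τ : Store} {i : ℕ} (h : Agree {7, 8, 9, 11} σ τ)
    (h7 : vec d τ 7 i = vec d σ 7 i) : newPoint d τ i = newPoint d σ i := by
  rw [newPoint, newPoint, h7, h.vec d (by norm_num) (by simp), h.vec d (by norm_num) (by simp),
    h.realArr_lt (by norm_num) (by simp), h.realArr_lt (by norm_num) (by simp),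
    h.realArr_lt (by norm_num) (by simp)]

theorem runs_points (d : ℕ) (σ : Store) :
    Runs (forUp (sizePlus 2) (pointBody d)) σ
      ((σ.natVar 0 + 2 + 1) * ((sizePlus 2).cost + (pointBody d).time + 7)) fun τ =>
        Agree {7, 8, 9, 11} σ τ ∧ ∀ i ≤ σ.natVar 0 + 1, vec d τ 7 i = newPoint d σ i ∧
          vec d τ 8 i = (2 : ℕ) • newPoint d σ i - vec d σ 7 i ∧
          vec d τ 11 i = vec d σ 11 i + newPoint d σ i := by
  refine (runs_forUp (loopFree_pointBody d) (m := σ.natVar 0 + 2) (I := fun k τ =>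
    Agree {7, 8, 9, 11} σ τ ∧
      vec d τ 7 = (fun i => if i < k then newPoint d σ i else vec d σ 7 i) ∧
      vec d τ 8 = (fun i => if i < k then (2 : ℕ) • newPoint d σ i - vec d σ 7 i
        else vec d σ 8 i) ∧
      vec d τ 11 = fun i => if i < k then vec d σ 11 i + newPoint d σ i else vec d σ 11 i)
    ?_ ?_ ?_ ?_ ?_).mono le_rfl ?_
  · rintro k τ ⟨h, -⟩
    rw [eval_sizePlus, h.natVar]
  · rintro k hk τ ⟨h, h7, h8, h11⟩ hidx
    obtain ⟨-, g, g7, g8, g11⟩ := run_pointBody d τ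
    have e7 : vec d τ 7 k = vec d σ 7 k := by simp [h7]
    have e11 : vec d τ 11 k = vec d σ 11 k := by simp [h11]
    rw [hidx, newPoint_congr h e7] at g7 g8 g11
    rw [e7] at g8
    rw [e11] at g11
    refine ⟨h.trans g, ?_, ?_, ?_⟩
    · rw [g7, h7]
      exact update_ite fun i => Nat.lt_succ_iff_lt_or_eq
    · rw [g8, h8]
      exact update_ite (f := fun i => (2 : ℕ) • newPoint d σ i - vec d σ 7 i)
        fun i => Nat.lt_succ_iff_lt_or_eq
    · rw [g11, h11]
      exact update_ite (f := fun i => vec d σ 11 i + newPoint d σ i)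
        fun i => Nat.lt_succ_iff_lt_or_eq
  · exact fun τ => (run_pointBody d τ).1
  · rintro k τ v ⟨h, h'⟩
    exact ⟨h.setIndex v, h'⟩
  · exact ⟨Agree.refl _ _, by simp⟩
  · rintro τ ⟨h, h7, h8, h11⟩
    refine ⟨h, fun i hi => ?_⟩
    have : i < σ.natVar 0 + 2 := by omega
    simp [h7, h8, h11, this]

theorem runs_duals (d : ℕ) (σ : Store) :
    Runs (forUp (sizePlus 1) (dualBody d)) σ
      ((σ.natVar 0 + 1 + 1) * ((sizePlus 1).cost + (dualBody d).time + 7)) fun τ =>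
        Agree {10} σ τ ∧ vec d τ 10 = fun i => if 0 < i ∧ i < σ.natVar 0 + 2
          then newDual d σ (i - 1) else vec d σ 10 i := by
  refine (runs_forUp (loopFree_dualBody d) (m := σ.natVar 0 + 1) (I := fun k τ =>
    Agree {10} σ τ ∧ vec d τ 10 = fun i => if 0 < i ∧ i < k + 1
      then newDual d σ (i - 1) else vec d σ 10 i)
    ?_ ?_ ?_ ?_ ?_).mono le_rfl ?_
  · rintro k τ ⟨h, -⟩
    rw [eval_sizePlus, h.natVar]
  · rintro k hk τ ⟨h, h10⟩ hidx
    obtain ⟨-, g, g10⟩ := run_dualBody d τ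
    have e10 : vec d τ 10 (k + 1) = vec d σ 10 (k + 1) := by simp [h10]
    -- Among the edge vectors, only the one being updated is read, and it still has its old value.
    have e : newDual d τ k = newDual d σ (k + 1 - 1) := by
      rw [newDual, e10, h.vec d (by norm_num) (by simp), h.realArr_lt (by norm_num) (by simp),
        h.realArr_lt (by norm_num) (by simp)]
      rfl
    rw [hidx, e] at g10
    refine ⟨h.trans g, ?_⟩
    rw [g10, h10]
    exact update_ite (f := fun i => newDual d σ (i - 1)) fun i => by omega
  · exact fun τ => (run_dualBody d τ).1
  · rintro k τ v ⟨h, h'⟩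
    exact ⟨h.setIndex v, h'⟩
  · refine ⟨Agree.refl _ _, ?_⟩
    funext i
    rw [if_neg (by omega)]
  · rintro τ ⟨h, h10⟩
    exact ⟨h, h10⟩

/-! ### Initialisation: input, greedy path and step sizes -/

theorem run_writeReal (F : ℕ) (i : NatExpr) (e : RealExpr) (σ : Store) :
    (Prog.writeReal F i e).run σ = σ.sstore F (i.eval σ) (e.eval σ) := rfl

theorem run_seq (P Q : Prog) (σ : Store) : (Prog.seq P Q).run σ = Q.run (P.run σ) := rfl

/-- The product of `k` and `e`. -/
def mulConst : ℕ → NatExpr → NatExpr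
  | 0, _ => .const 0
  | k + 1, e => .plus (mulConst k e) e

@[simp] theorem eval_mulConst (k : ℕ) (e : NatExpr) (σ : Store) :
    (mulConst k e).eval σ = k * e.eval σ := by
  induction k with
  | zero => simp [mulConst, NatExpr.eval]
  | succ k ih => rw [mulConst, NatExpr.eval, ih]; ring

/-- Copy one centre and one radius of the input. -/
def loadBody (d : ℕ) : Prog :=
  .seq (vset 5 idxSucc (fun j => .read 2 (.plus (mulConst d idx) (.const j))) d)
    (.writeReal 6 idxSucc (.read 3 idx))

theorem loopFree_loadBody (d : ℕ) : (loadBody d).LoopFree := ⟨loopFree_vset _ _ _ _, trivial⟩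

theorem run_loadBody (d : ℕ) (σ : Store) {v : Space d}
    (hv : ∀ j : Fin d, σ.realArr 2 (d * σ.natVar 1 + j) = v j) :
    (loadBody d).run σ = (σ.vstore 5 (σ.natVar 1 + 1) v).sstore 6 (σ.natVar 1 + 1)
      (σ.realArr 3 (σ.natVar 1)) := by
  rw [loadBody, Prog.run, run_vset (σ := σ) v (by norm_num)
    (fun j => by simp [RealExpr.eval, NatExpr.eval, hv]) (fun τ hτ => by simp [hτ])
    (fun j m hm f => by simp [RealExpr.eval, NatExpr.eval, realArr_vwrite_of_ne]), run_writeReal]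
  simp [RealExpr.eval, realArr_vstore_of_ne]

theorem runs_load {d n : ℕ} {σ : Store} {c : Fin n → Space d} {r : Fin n → ℝ}
    (hn : σ.natVar 0 = n) (hc : ∀ (i : Fin n) (j : Fin d), σ.realArr 2 (i * d + j) = c i j)
    (hr : ∀ i : Fin n, σ.realArr 3 i = r i) :
    Runs (forUp (sizePlus 0) (loadBody d)) σ
      ((n + 1) * ((sizePlus 0).cost + (loadBody d).time + 7)) fun τ =>
        Agree {5, 6} σ τ ∧ ∀ i : Fin n, vec d τ 5 (i + 1) = c i ∧ τ.realArr 6 (i + 1) = r i := by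
  refine (runs_forUp (loopFree_loadBody d) (m := n) (I := fun k τ => Agree {5, 6} σ τ ∧
    ∀ i : Fin n, (i : ℕ) < k → vec d τ 5 (i + 1) = c i ∧ τ.realArr 6 (i + 1) = r i)
    ?_ ?_ ?_ ?_ ?_).mono le_rfl ?_
  · rintro k τ ⟨h, -⟩
    rw [eval_sizePlus, h.natVar, hn, add_zero]
  · rintro k hk τ ⟨h, h'⟩ hidx
    rw [run_loadBody d τ (v := c ⟨k, hk⟩) fun j => by
      rw [hidx, h.realArr_lt (by norm_num) (by simp), mul_comm]; exact hc ⟨k, hk⟩ j]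
    refine ⟨(h.vstore (by simp) _ _).sstore (by simp) (by norm_num) _ _, fun i hi => ?_⟩
    rw [vec_sstore_of_ne _ _ (by norm_num) (by norm_num) (by norm_num),
      vec_vstore_self _ (by norm_num), realArr_sstore_self,
      realArr_vstore_of_ne _ _ _ _ (by norm_num), hidx,
      h.realArr_lt (F := 3) (by norm_num) (by simp)]
    rcases Nat.lt_succ_iff_lt_or_eq.1 hi with hi | hi
    · have : (i : ℕ) + 1 ≠ k + 1 := by omega
      rw [Function.update_of_ne this, Function.update_of_ne this]
      exact h' i hi
    · subst hi
      simp [hr]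
  · intro τ
    rw [run_loadBody d τ (v := WithLp.toLp 2 fun j : Fin d => τ.realArr 2 (d * τ.natVar 1 + j))
      fun j => rfl]
    rfl
  · rintro k τ v ⟨h, h'⟩
    exact ⟨h.setIndex v, h'⟩
  · exact ⟨Agree.refl _ _, fun i hi => absurd hi (Nat.not_lt_zero _)⟩
  · rintro τ ⟨h, h'⟩
    exact ⟨h, fun i => h' i i.2⟩

/-- Set up the two ends and the first entries of the recursively computed arrays. -/
def endsProg (d : ℕ) : Prog :=
  .seq (vset 5 (.const 0) (fun j => .read 0 (.const j)) d)
    (.seq (vset 5 (sizePlus 1) (fun j => .read 1 (.const j)) d)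
      (.seq (vset 7 (.const 0) (fun j => .read 0 (.const j)) d)
        (.seq (.writeReal 6 (.const 0) (.const 0))
          (.seq (.writeReal 6 (sizePlus 1) (.const 0))
            (.seq (.writeReal 12 (.const 0) (.const 0)) (.writeReal 13 (sizePlus 1) (.const 0)))))))

theorem loopFree_endsProg (d : ℕ) : (endsProg d).LoopFree :=
  ⟨loopFree_vset _ _ _ _, loopFree_vset _ _ _ _, loopFree_vset _ _ _ _, trivial, trivial, trivial,
    trivial⟩

theorem run_endsProg {d n : ℕ} {σ : Store} {start finish : Space d} (hn : σ.natVar 0 = n)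
    (hs : ∀ j : Fin d, σ.realArr 0 j = start j) (hf : ∀ j : Fin d, σ.realArr 1 j = finish j) :
    (endsProg d).run σ = ((((((σ.vstore 5 0 start).vstore 5 (n + 1) finish).vstore 7 0 start).sstore
      6 0 0).sstore 6 (n + 1) 0).sstore 12 0 0).sstore 13 (n + 1) 0 := by
  simp only [endsProg, run_seq]
  rw [run_vset (σ := σ) start (by norm_num) (fun j => by simp [RealExpr.eval, NatExpr.eval, hs])
    (fun τ hτ => rfl)
    (fun j m hm f => by simp [RealExpr.eval, NatExpr.eval, realArr_vwrite_of_ne])]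
  set σ₁ := σ.vstore 5 (NatExpr.eval σ (.const 0)) start with hσ₁
  rw [run_vset (σ := σ₁) finish (by norm_num)
    (fun j => by simp [RealExpr.eval, NatExpr.eval, hf, hσ₁, realArr_vstore_of_ne])
    (fun τ hτ => by simp [hτ])
    (fun j m hm f => by simp [RealExpr.eval, NatExpr.eval, realArr_vwrite_of_ne])]
  set σ₂ := σ₁.vstore 5 (NatExpr.eval σ₁ (sizePlus 1)) finish with hσ₂
  rw [run_vset (σ := σ₂) start (by norm_num)
    (fun j => by simp [RealExpr.eval, NatExpr.eval, hs, hσ₂, hσ₁, realArr_vstore_of_ne])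
    (fun τ hτ => rfl)
    (fun j m hm f => by simp [RealExpr.eval, NatExpr.eval, realArr_vwrite_of_ne])]
  simp [run_writeReal, hσ₂, hσ₁, NatExpr.eval, RealExpr.eval, hn]

/-- Clear one edge vector and one sum of points. -/
def clearBody (d : ℕ) : Prog :=
  .seq (vset 10 idx (fun _ => .const 0) d) (vset 11 idx (fun _ => .const 0) d)

theorem loopFree_clearBody (d : ℕ) : (clearBody d).LoopFree :=
  ⟨loopFree_vset _ _ _ _, loopFree_vset _ _ _ _⟩

theorem run_clearBody (d : ℕ) (σ : Store) : (clearBody d).run σ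
    = (σ.vstore 10 (σ.natVar 1) (0 : Space d)).vstore 11 (σ.natVar 1) (0 : Space d) := by
  rw [clearBody, Prog.run, run_vset (σ := σ) 0 (by norm_num) (fun j => by simp [RealExpr.eval])
    (fun τ hτ => by simp [hτ]) (fun j m hm f => rfl),
    run_vset 0 (by norm_num) (fun j => by simp [RealExpr.eval])
    (fun τ hτ => by simp [hτ]) (fun j m hm f => rfl)]
  simp

/-- Edge vectors are indexed up to n + 2: the n + 1 edges are framed by a zero vector on either
side. -/
theorem runs_clear (d : ℕ) (σ : Store) :
    Runs (forUp (sizePlus 3) (clearBody d)) σ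
      ((σ.natVar 0 + 3 + 1) * ((sizePlus 3).cost + (clearBody d).time + 7)) fun τ =>
        Agree {10, 11} σ τ ∧ ∀ i < σ.natVar 0 + 3, vec d τ 10 i = 0 ∧ vec d τ 11 i = 0 := by
  refine (runs_forUp (loopFree_clearBody d) (m := σ.natVar 0 + 3) (I := fun k τ =>
    Agree {10, 11} σ τ ∧ ∀ i < k, vec d τ 10 i = 0 ∧ vec d τ 11 i = 0)
    ?_ ?_ ?_ ?_ ?_).mono le_rfl fun τ h => h
  · rintro k τ ⟨h, -⟩
    rw [eval_sizePlus, h.natVar]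
  · rintro k hk τ ⟨h, h'⟩ hidx
    rw [run_clearBody, hidx]
    refine ⟨(h.vstore (by simp) _ _).vstore (by simp) _ _, fun i hi => ?_⟩
    rw [vec_vstore_of_ne _ (by norm_num) (by norm_num), vec_vstore_self _ (by norm_num),
      vec_vstore_self _ (by norm_num), vec_vstore_of_ne _ (by norm_num) (by norm_num)]
    rcases Nat.lt_succ_iff_lt_or_eq.1 hi with hi | rfl
    · rw [Function.update_of_ne hi.ne, Function.update_of_ne hi.ne]
      exact h' i hi
    · simp
  · intro τ
    rw [run_clearBody]
    rfl
  · rintro k τ v ⟨h, h'⟩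
    exact ⟨h.setIndex v, h'⟩
  · exact ⟨Agree.refl _ _, fun i hi => absurd hi (Nat.not_lt_zero _)⟩

/-- One step of the greedy path and of the smoothing of its edge lengths. -/
def greedyBody (d : ℕ) : Prog :=
  .seq (vset 7 idxSucc (coord 7 idx) d)
    (.seq (projectProg d 7 idxSucc (coord 5 idxSucc) (.read 6 idxSucc))
      (.seq (.writeReal 14 idx (distExpr (coord 7 idx) (coord 7 idxSucc) d))
        (.writeReal 12 idxSucc (.plus (.div (.read 12 idx) (.const 2)) (.read 14 idx)))))

theorem loopFree_greedyBody (d : ℕ) : (greedyBody d).LoopFree :=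
  ⟨loopFree_vset _ _ _ _, loopFree_projectProg _ _ _ _ _, trivial, trivial⟩

theorem run_greedyBody {d i : ℕ} {σ : Store} {p : Space d} (hi : σ.natVar 1 = i)
    (hp : ballProj (vec d σ 5 (i + 1)) (σ.realArr 6 (i + 1)) (vec d σ 7 i) = p) :
    ((greedyBody d).run σ).natVar = σ.natVar ∧ Agree {7, 12, 14} σ ((greedyBody d).run σ) ∧
    vec d ((greedyBody d).run σ) 7 = Function.update (vec d σ 7) (i + 1) p ∧
    ((greedyBody d).run σ).realArr 14
      = Function.update (σ.realArr 14) i (dist (vec d σ 7 i) p) ∧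
    ((greedyBody d).run σ).realArr 12 = Function.update (σ.realArr 12) (i + 1)
      (σ.realArr 12 i / 2 + dist (vec d σ 7 i) p) := by
  simp only [greedyBody, run_seq]
  rw [run_vset (σ := σ) (vec d σ 7 i) (by norm_num) (fun j => by simp [eval_coord, hi])
    (fun τ hτ => by simp [hτ]) (fun j m hm f => by simp [eval_idx_vwrite hm])]
  set σ₁ := σ.vstore 7 (idxSucc.eval σ) (vec d σ 7 i) with hσ₁
  have hi₁ : σ₁.natVar 1 = i := hi
  obtain ⟨f, hf0, hf3, hrun⟩ := run_projectProg (d := d) (F := 7) (i := idxSucc)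
    (c := coord 5 idxSucc) (r := .read 6 idxSucc) (σ := σ₁) (ctr := vec d σ 5 (i + 1))
    (rad := σ.realArr 6 (i + 1)) (by norm_num)
    (fun τ hτ => by simp [hτ])
    (fun τ hτ ha j => by
      simp only [coord, RealExpr.eval, eval_idxSucc, hτ]
      rw [ha _ (by omega)])
    (fun j => by
      rw [eval_coord, hσ₁, vec_vstore_of_ne _ (by norm_num) (by norm_num), ← hσ₁, eval_idxSucc,
        hi₁])
    (fun τ hτ ha => by
      simp only [RealExpr.eval, eval_idxSucc, hτ]
      rw [ha _ (by norm_num), hσ₁, realArr_vstore_of_ne _ _ _ _ (by norm_num), ← hσ₁, hi₁])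
  have hq : vec d σ₁ 7 (idxSucc.eval σ₁) = vec d σ 7 i := by
    rw [hσ₁, vec_vstore_self _ (by norm_num)]
    simp
  rw [hrun, hq, hp, eval_idxSucc, hi₁]
  set σ₂ := ({ σ₁ with realVar := f } : Store).vstore 7 (i + 1) p with hσ₂
  have hi₂ : σ₂.natVar 1 = i := hi
  have h2 : vec d σ₂ 7 = Function.update (vec d σ 7) (i + 1) p := by
    rw [hσ₂, vec_vstore_self _ (by norm_num), vec_setRealVar, hσ₁, vec_vstore_self _ (by norm_num),
      eval_idxSucc, hi, Function.update_idem]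
  have h2a : ∀ a, a % 16 ≠ 7 → σ₂.realArr a = σ.realArr a := fun a ha => by
    rw [hσ₂, realArr_vstore_of_ne _ _ _ _ ha]
    exact realArr_vstore_of_ne _ _ _ _ ha
  have hd : (distExpr (coord 7 idx) (coord 7 idxSucc) d).eval σ₂ = dist (vec d σ 7 i) p :=
    eval_distExpr (fun j => by simp [eval_coord, hi₂, h2]) (fun j => by simp [eval_coord, hi₂, h2])
  rw [run_writeReal _ _ _ σ₂, hd, run_writeReal]
  simp only [eval_idx, eval_idxSucc, natVar_sstore, hi₂, RealExpr.eval, Rat.cast_ofNat]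
  refine ⟨rfl, ?_, ?_, ?_, ?_⟩
  · exact ((((((Agree.refl _ σ).vstore (by simp) _ _).setRealVar hf0 hf3).vstore (by simp)
      _ _)).sstore (by simp) (by norm_num) _ _).sstore (by simp) (by norm_num) _ _
  · rw [vec_sstore_of_ne _ _ (by norm_num) (by norm_num) (by norm_num),
      vec_sstore_of_ne _ _ (by norm_num) (by norm_num) (by norm_num), h2]
  · rw [realArr_sstore_of_ne _ _ _ _ (by norm_num), realArr_sstore_self, h2a _ (by norm_num)]
  · rw [realArr_sstore_self, realArr_sstore_of_ne _ _ _ _ (by norm_num), realArr_sstore_self,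
      h2a _ (by norm_num)]
    simp

theorem runs_greedy {d n : ℕ} {σ : Store} {c : ℕ → Space d} {r : ℕ → ℝ} (hn : σ.natVar 0 = n)
    (hc : ∀ i ≤ n + 1, vec d σ 5 i = c i) (hr : ∀ i ≤ n + 1, σ.realArr 6 i = r i)
    (h0 : vec d σ 7 0 = c 0) (ha : σ.realArr 12 0 = 0) :
    Runs (forUp (sizePlus 1) (greedyBody d)) σ
      ((n + 1 + 1) * ((sizePlus 1).cost + (greedyBody d).time + 7)) fun τ =>
        Agree {7, 12, 14} σ τ ∧ (∀ i ≤ n + 1, vec d τ 7 i = greedy c r i ∧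
          τ.realArr 12 i = smooth (edge (greedy c r)) i) ∧
          ∀ i < n + 1, τ.realArr 14 i = edge (greedy c r) i := by
  refine (runs_forUp (loopFree_greedyBody d) (m := n + 1) (I := fun k τ =>
    Agree {7, 12, 14} σ τ ∧ (∀ i ≤ k, vec d τ 7 i = greedy c r i ∧
          τ.realArr 12 i = smooth (edge (greedy c r)) i) ∧
          ∀ i < k, τ.realArr 14 i = edge (greedy c r) i)
    ?_ ?_ ?_ ?_ ?_).mono le_rfl fun τ h => h
  · rintro k τ ⟨h, -⟩
    rw [eval_sizePlus, h.natVar, hn]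
  · rintro k hk τ ⟨h, h1, h2⟩ hidx
    obtain ⟨-, g, g7, g14, g12⟩ := run_greedyBody (p := greedy c r (k + 1)) hidx (by
      rw [h.vec d (by norm_num) (by simp), h.realArr_lt (by norm_num) (by simp), hc _ hk, hr _ hk,
        (h1 k le_rfl).1]
      rfl)
    refine ⟨h.trans g, fun i hi => ?_, fun i hi => ?_⟩
    · rw [g7, g12]
      rcases hi.lt_or_eq with hi | rfl
      · rw [Function.update_of_ne hi.ne, Function.update_of_ne hi.ne]
        exact h1 i (Nat.lt_succ_iff.1 hi)
      · simp only [Function.update_self, true_and]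
        rw [(h1 k le_rfl).1, (h1 k le_rfl).2]
        rfl
    · rw [g14]
      rcases Nat.lt_succ_iff_lt_or_eq.1 hi with hi | rfl
      · rw [Function.update_of_ne hi.ne]
        exact h2 i hi
      · rw [Function.update_self, (h1 i le_rfl).1]
        rfl
  · exact fun τ => (run_greedyBody rfl rfl).1
  · rintro k τ v ⟨h, h'⟩
    exact ⟨h.setIndex v, h'⟩
  · refine ⟨Agree.refl _ _, fun i hi => ?_, fun i hi => absurd hi (Nat.not_lt_zero _)⟩
    obtain rfl := Nat.le_zero.1 hi
    exact ⟨h0, ha⟩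

/-- The number of balls minus the loop index. -/
def idxRev : NatExpr := .minus (.var 0) (.var 1)

/-- One step of the smoothing of the edge lengths from the right. -/
def backBody : Prog :=
  .writeReal 13 idxRev (.plus (.div (.read 13 (.plus idxRev (.const 1))) (.const 2))
    (.read 14 idxRev))

theorem run_backBody {n i : ℕ} {σ : Store} (hn : σ.natVar 0 = n) (hi : σ.natVar 1 = i) :
    backBody.run σ
      = σ.sstore 13 (n - i) (σ.realArr 13 (n - i + 1) / 2 + σ.realArr 14 (n - i)) := by
  simp [backBody, run_writeReal, idxRev, NatExpr.eval, RealExpr.eval, hn, hi]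

theorem runs_back {n : ℕ} {σ : Store} {l : ℕ → ℝ} (hn : σ.natVar 0 = n)
    (hl : ∀ i < n + 1, σ.realArr 14 i = l i) (h0 : σ.realArr 13 (n + 1) = 0) :
    Runs (forUp (sizePlus 1) backBody) σ ((n + 1 + 1) * ((sizePlus 1).cost + backBody.time + 7))
      fun τ => Agree {13} σ τ ∧ ∀ i ≤ n + 1, τ.realArr 13 i = smoothRev (n + 1) l i := by
  refine (runs_forUp (P := backBody) trivial (m := n + 1) (I := fun k τ =>
    Agree {13} σ τ ∧ ∀ i ≤ n + 1, n + 1 ≤ i + k → τ.realArr 13 i = smoothRev (n + 1) l i)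
    ?_ ?_ ?_ ?_ ?_).mono le_rfl ?_
  · rintro k τ ⟨h, -⟩
    rw [eval_sizePlus, h.natVar, hn]
  · rintro k hk τ ⟨h, h'⟩ hidx
    rw [run_backBody (h.natVar.trans hn) hidx]
    refine ⟨h.sstore (by simp) (by norm_num) _ _, fun i hi hik => ?_⟩
    rw [realArr_sstore_self]
    -- Round k fills position n - k from position n - k + 1; the truncated subtraction is exact
    -- since k ≤ n.
    rcases eq_or_ne i (n - k) with rfl | hne
    · rw [Function.update_self, h' _ (by omega) (by omega), h.realArr_lt (by norm_num) (by simp),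
        hl _ (by omega), smoothRev_of_lt _ (by omega : n - k < n + 1)]
    · rw [Function.update_of_ne hne]
      exact h' i hi (by omega)
  · intro τ
    rw [run_backBody rfl rfl]
    rfl
  · rintro k τ v ⟨h, h'⟩
    exact ⟨h.setIndex v, h'⟩
  · refine ⟨Agree.refl _ _, fun i hi hi' => ?_⟩
    obtain rfl : i = n + 1 := by omega
    rw [h0, smoothRev_self]
  · rintro τ ⟨h, h'⟩
    exact ⟨h, fun i hi => h' i hi (by omega)⟩

/-! ### The iteration invariant, the main loop and the output -/

/-- The memory after `q` iterations for the balls with centres `c` and radii `r`. -/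
structure HoldsIterate (d n : ℕ) (ε : ℝ) (c : ℕ → Space d) (r : ℕ → ℝ) (q : ℕ) (σ : Store) :
    Prop where
  size : σ.natVar 0 = n
  accuracy : σ.realVar 0 = ε
  count : σ.realVar 3 = q
  centres : ∀ i ≤ n + 1, vec d σ 5 i = c i
  radii : ∀ i ≤ n + 1, σ.realArr 6 i = r i
  steps : ∀ i ≤ n + 1, σ.realArr 12 i + σ.realArr 13 i = stepSize (n + 1) (greedy c r) i
  points : ∀ i ≤ n + 1, vec d σ 7 i = (touringIter (n + 1) c r q).1 i
  duals : ∀ i ≤ n + 2, vec d σ 10 i = (touringIter (n + 1) c r q).2 i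
  sums : ∀ i ≤ n + 1, vec d σ 11 i = ∑ k ∈ range q, (touringIter (n + 1) c r (k + 1)).1 i

/-- Everything before the first iteration. -/
def setupProg (d : ℕ) : Prog :=
  .seq (forUp (sizePlus 0) (loadBody d)) (.seq (endsProg d) (.seq (forUp (sizePlus 3) (clearBody d))
    (.seq (forUp (sizePlus 1) (greedyBody d)) (.seq (forUp (sizePlus 1) backBody)
      (.setReal 3 (.const 0))))))

theorem runs_setupProg (d : ℕ) : ∃ T : ℕ, ∀ {n : ℕ} {ε : ℝ} {start finish : Space d}
    {c : Fin n → Space d} {r : Fin n → ℝ} {σ : Store}, HoldsInput σ ε start finish c r →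
    Runs (setupProg d) σ (T * (n + 1))
      (HoldsIterate d n ε (extend start finish c) (extend 0 0 r) 0) := by
  -- The factors 4 and 2 come from n + 4 ≤ 4 (n + 1) and n + 2 ≤ 2 (n + 1), so the constant depends
  -- on d alone.
  refine ⟨((sizePlus 0).cost + (loadBody d).time + 7) + (endsProg d).time
    + 4 * ((sizePlus 3).cost + (clearBody d).time + 7)
    + 2 * ((sizePlus 1).cost + (greedyBody d).time + 7)
    + 2 * ((sizePlus 1).cost + backBody.time + 7) + 2, ?_⟩
  intro n ε start finish c r σ h
  set cc := extend start finish c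
  set rr := extend 0 0 r
  refine ((runs_load h.size h.centres h.radii).seq (Q' := fun τ =>
    HoldsIterate d n ε cc rr 0 τ) (T' := (endsProg d).time
    + ((n + 3 + 1) * ((sizePlus 3).cost + (clearBody d).time + 7)
    + ((n + 1 + 1) * ((sizePlus 1).cost + (greedyBody d).time + 7)
    + ((n + 1 + 1) * ((sizePlus 1).cost + backBody.time + 7) + 2)))) ?_).mono ?_ fun _ h => h
  · rintro σ₁ ⟨h₁, hload⟩
    have hn₁ : σ₁.natVar 0 = n := h₁.natVar.trans h.size
    refine Runs.seq (Q := fun τ => τ.natVar 0 = n ∧ τ.realVar 0 = ε ∧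
        (∀ i ≤ n + 1, vec d τ 5 i = cc i) ∧ (∀ i ≤ n + 1, τ.realArr 6 i = rr i) ∧
        vec d τ 7 0 = start ∧ τ.realArr 12 0 = 0 ∧ τ.realArr 13 (n + 1) = 0)
      ((loopFree_endsProg d).runs ?_) ?_
    · rw [run_endsProg (start := start) (finish := finish) hn₁
        (fun j => by rw [h₁.realArr_lt (by norm_num) (by simp)]; exact h.start j)
        (fun j => by rw [h₁.realArr_lt (by norm_num) (by simp)]; exact h.finish j)]
      refine ⟨hn₁, h₁.realVar_zero.trans h.accuracy, ?_, ?_, ?_, ?_, ?_⟩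
      · simp only [vec_sstore_of_ne _ _ (by norm_num : 13 < 16) (by norm_num : 5 < 16),
          vec_sstore_of_ne _ _ (by norm_num : 12 < 16) (by norm_num : 5 < 16),
          vec_sstore_of_ne _ _ (by norm_num : 6 < 16) (by norm_num : 5 < 16), ne_eq,
          Nat.reduceEqDiff, not_false_eq_true,
          vec_vstore_of_ne _ (by norm_num : 5 < 16), vec_vstore_self _ (by norm_num : 5 < 16)]
        refine index_cases ?_ (fun i => ?_) ?_
        · simp [cc]
        · have : (i : ℕ) ≠ n := i.2.ne
          simp [cc, this, (hload i).1]
        · simp [cc]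
      · simp only [realArr_sstore_of_ne _ 13 _ _ (by norm_num : 6 ≠ 13),
          realArr_sstore_of_ne _ 12 _ _ (by norm_num : 6 ≠ 12), realArr_sstore_self,
          realArr_vstore_of_ne _ 7 _ _ (by norm_num : 6 % 16 ≠ 7),
          realArr_vstore_of_ne _ 5 _ _ (by norm_num : 6 % 16 ≠ 5)]
        refine index_cases ?_ (fun i => ?_) ?_
        · simp [rr]
        · have : (i : ℕ) ≠ n := i.2.ne
          simp [rr, this, (hload i).2]
        · simp [rr]
      · simp only [vec_sstore_of_ne _ _ (by norm_num : 13 < 16) (by norm_num : 7 < 16),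
          vec_sstore_of_ne _ _ (by norm_num : 12 < 16) (by norm_num : 7 < 16),
          vec_sstore_of_ne _ _ (by norm_num : 6 < 16) (by norm_num : 7 < 16), ne_eq,
          Nat.reduceEqDiff, not_false_eq_true,
          vec_vstore_self _ (by norm_num : 7 < 16), Function.update_self]
      · rw [realArr_sstore_of_ne _ _ _ _ (by norm_num), realArr_sstore_self,
          Function.update_self]
      · rw [realArr_sstore_self, Function.update_self]
    rintro σ₂ ⟨hn₂, hε₂, hc₂, hr₂, hs₂, ha₂, hb₂⟩
    have hclear := runs_clear d σ₂
    rw [hn₂] at hclear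
    refine hclear.seq ?_
    rintro σ₃ ⟨h₃, hz₃⟩
    refine (runs_greedy (d := d) (n := n) (c := cc) (r := rr) (h₃.natVar.trans hn₂)
      (fun i hi => by rw [h₃.vec d (by norm_num) (by simp), hc₂ i hi])
      (fun i hi => by rw [h₃.realArr_lt (by norm_num) (by simp), hr₂ i hi])
      (by rw [h₃.vec d (by norm_num) (by simp), hs₂]; simp [cc])
      (by rw [h₃.realArr_lt (by norm_num) (by simp), ha₂])).seq ?_
    rintro σ₄ ⟨h₄, hg₄, hl₄⟩
    refine (runs_back (h₄.natVar.trans (h₃.natVar.trans hn₂)) hl₄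
      (by rw [h₄.realArr_lt (by norm_num) (by simp), h₃.realArr_lt (by norm_num) (by simp),
        hb₂])).seq ?_
    rintro σ₅ ⟨h₅, hb₅⟩
    refine ⟨_, _, .setReal _ _ _, le_rfl, ?_⟩
    exact
      { size := h₅.natVar.trans (h₄.natVar.trans (h₃.natVar.trans hn₂))
        accuracy := by
          simp only [ne_eq, OfNat.zero_ne_ofNat, not_false_eq_true, Function.update_of_ne]
          exact h₅.realVar_zero.trans (h₄.realVar_zero.trans (h₃.realVar_zero.trans hε₂))
        count := by simp [RealExpr.eval]
        centres := fun i hi => by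
          rw [vec_setRealVar, h₅.vec d (by norm_num) (by simp), h₄.vec d (by norm_num) (by simp),
            h₃.vec d (by norm_num) (by simp), hc₂ i hi]
        radii := fun i hi => by
          change σ₅.realArr 6 i = _
          rw [h₅.realArr_lt (by norm_num) (by simp), h₄.realArr_lt (by norm_num) (by simp),
            h₃.realArr_lt (by norm_num) (by simp), hr₂ i hi]
        steps := fun i hi => by
          change σ₅.realArr 12 i + σ₅.realArr 13 i = _
          rw [hb₅ i hi, h₅.realArr_lt (by norm_num) (by simp), (hg₄ i hi).2]
          rfl
        points := fun i hi => by
          rw [vec_setRealVar, h₅.vec d (by norm_num) (by simp), (hg₄ i hi).1]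
          rfl
        duals := fun i hi => by
          rw [vec_setRealVar, h₅.vec d (by norm_num) (by simp), h₄.vec d (by norm_num) (by simp),
            (hz₃ i (by omega)).1]
          rfl
        sums := fun i hi => by
          rw [vec_setRealVar, h₅.vec d (by norm_num) (by simp), h₄.vec d (by norm_num) (by simp),
            (hz₃ i (by omega)).2]
          simp }
  · have key : ∀ a b e f g : ℕ,
        (n + 1) * a + (g + ((n + 3 + 1) * b + ((n + 1 + 1) * e + ((n + 1 + 1) * f + 2))))
          ≤ (a + g + 4 * b + 2 * e + 2 * f + 2) * (n + 1) := fun a b e f g => by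
      have : (a + g + 4 * b + 2 * e + 2 * f + 2) * (n + 1)
          = (n + 1) * a + (g + ((n + 3 + 1) * b + ((n + 1 + 1) * e + ((n + 1 + 1) * f + 2))))
            + (n * g + 3 * (n * b) + n * e + n * f + 2 * n) := by ring
      omega
    exact key _ _ _ _ _

/-- One iteration. -/
def iterateProg (d : ℕ) : Prog :=
  .seq (forUp (sizePlus 2) (pointBody d)) (.seq (forUp (sizePlus 1) (dualBody d))
    (.setReal 3 (.plus (.var 3) (.const 1))))

theorem runs_iterateProg (d : ℕ) : ∃ T : ℕ, ∀ {n : ℕ} {ε : ℝ} {c : ℕ → Space d} {r : ℕ → ℝ}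
    {q : ℕ} {σ : Store}, HoldsIterate d n ε c r q σ →
    Runs (iterateProg d) σ (T * (n + 1)) (HoldsIterate d n ε c r (q + 1)) := by
  refine ⟨3 * ((sizePlus 2).cost + (pointBody d).time + 7)
    + 2 * ((sizePlus 1).cost + (dualBody d).time + 7) + 4, ?_⟩
  intro n ε c r q σ h
  have hpts := runs_points d σ
  rw [h.size] at hpts
  refine (hpts.seq (T' := (n + 1 + 1) * ((sizePlus 1).cost + (dualBody d).time + 7) + 4)
    (Q' := HoldsIterate d n ε c r (q + 1)) ?_).mono ?_ fun _ h => h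
  · rintro σ₁ ⟨h₁, hp₁⟩
    have hn₁ : σ₁.natVar 0 = n := h₁.natVar.trans h.size
    have hdual := runs_duals d σ₁
    rw [hn₁] at hdual
    refine hdual.seq ?_
    rintro σ₂ ⟨h₂, hd₂⟩
    refine ⟨_, _, .setReal _ _ _, le_rfl, ?_⟩
    have hstep : ∀ i ≤ n + 1, newPoint d σ i = (touringIter (n + 1) c r (q + 1)).1 i := by
      intro i hi
      rw [newPoint, h.centres i hi, h.radii i hi, h.points i hi, h.steps i hi,
        h.duals i (by omega), h.duals (i + 1) (by omega)]
      rfl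
    have hsteps : ∀ i ≤ n + 1, σ₁.realArr 12 i + σ₁.realArr 13 i
        = stepSize (n + 1) (greedy c r) i := fun i hi => by
      rw [h₁.realArr_lt (by norm_num) (by simp), h₁.realArr_lt (by norm_num) (by simp),
        h.steps i hi]
    have hext : ∀ i ≤ n + 1, vec d σ₁ 8 i = (2 : ℕ) • (touringIter (n + 1) c r (q + 1)).1 i
        - (touringIter (n + 1) c r q).1 i := fun i hi => by
      rw [(hp₁ i hi).2.1, hstep i hi, h.points i hi]
    exact
      { size := h₂.natVar.trans hn₁
        accuracy := by
          simp only [ne_eq, OfNat.zero_ne_ofNat, not_false_eq_true, Function.update_of_ne]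
          exact h₂.realVar_zero.trans (h₁.realVar_zero.trans h.accuracy)
        count := by
          simp only [RealExpr.eval, Function.update_self, Rat.cast_one, Nat.cast_add, Nat.cast_one]
          rw [h₂.realVar_three, h₁.realVar_three, h.count]
        centres := fun i hi => by
          rw [vec_setRealVar, h₂.vec d (by norm_num) (by simp), h₁.vec d (by norm_num) (by simp),
            h.centres i hi]
        radii := fun i hi => by
          change σ₂.realArr 6 i = _
          rw [h₂.realArr_lt (by norm_num) (by simp), h₁.realArr_lt (by norm_num) (by simp),
            h.radii i hi]
        steps := fun i hi => by
          change σ₂.realArr 12 i + σ₂.realArr 13 i = _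
          rw [h₂.realArr_lt (by norm_num) (by simp), h₂.realArr_lt (by norm_num) (by simp),
            hsteps i hi]
        points := fun i hi => by
          rw [vec_setRealVar, h₂.vec d (by norm_num) (by simp), (hp₁ i hi).1, hstep i hi]
        duals := fun i hi => by
          rw [vec_setRealVar, hd₂]
          dsimp only
          rw [h₁.vec d (F := 10) (by norm_num) (by simp)]
          -- Index 0 and index n + 2 are not touched by the sweep and remain zero, as in `nextDual`.
          cases i with
          | zero =>
            have h0 : (touringIter (n + 1) c r q).2 0 = 0 := by cases q <;> rfl
            rw [if_neg (by omega), h.duals 0 (by omega), h0]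
            rfl
          | succ i =>
            rcases Nat.lt_or_ge i (n + 1) with hlt | hge
            · rw [if_pos (by omega), Nat.add_sub_cancel, newDual, hsteps i hlt.le,
                hsteps (i + 1) hlt, hext i hlt.le, hext (i + 1) hlt,
                h₁.vec d (F := 10) (by norm_num) (by simp), h.duals (i + 1) (by omega)]
              exact (if_pos hlt).symm
            · have h0 : (touringIter (n + 1) c r q).2 (i + 1) = 0 := by
                cases q with
                | zero => rfl
                | succ q => exact if_neg hge.not_gt
              rw [if_neg (by omega), h.duals (i + 1) (by omega), h0]
              exact (if_neg hge.not_gt).symm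
        sums := fun i hi => by
          rw [vec_setRealVar, h₂.vec d (by norm_num) (by simp), (hp₁ i hi).2.2, h.sums i hi,
            hstep i hi, sum_range_succ] }
  · have key : ∀ a b : ℕ, (n + 2 + 1) * a + ((n + 1 + 1) * b + 4)
        ≤ (3 * a + 2 * b + 4) * (n + 1) := fun a b => by
      have : (3 * a + 2 * b + 4) * (n + 1) = (n + 2 + 1) * a + ((n + 1 + 1) * b + 4)
          + (2 * (n * a) + n * b + 4 * n) := by ring
      omega
    exact key _ _

/-- All iterations. -/
def mainLoop (d : ℕ) : Prog :=
  .loop (.realLt (.times (.var 3) (.var 0)) (.const (touringConst d))) (iterateProg d)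

theorem runs_mainLoop (d : ℕ) : ∃ T : ℕ, ∀ {n : ℕ} {ε : ℝ} {c : ℕ → Space d} {r : ℕ → ℝ}
    {σ : Store}, 0 < ε → HoldsIterate d n ε c r 0 σ →
    Runs (mainLoop d) σ ((⌈touringConst d / ε⌉₊ + 1) * (T * (n + 1)))
      (HoldsIterate d n ε c r ⌈touringConst d / ε⌉₊) := by
  obtain ⟨T, hT⟩ := runs_iterateProg d
  refine ⟨T + 6, ?_⟩
  intro n ε c r σ hε h
  set N := ⌈touringConst d / ε⌉₊ with hN
  -- With the count q kept as a real number, the test q ε < `touringConst d` realises the ceiling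
  -- without any rounding operation.
  have htest : ∀ {q : ℕ} {σ : Store}, HoldsIterate d n ε c r q σ →
      (Test.eval σ (.realLt (.times (.var 3) (.var 0)) (.const (touringConst d))) ↔ q < N) := by
    intro q σ h
    simp only [Test.eval, RealExpr.eval, h.count, h.accuracy, Rat.cast_natCast]
    rw [hN, Nat.lt_ceil, lt_div_iff₀ hε]
  have key : ∀ l q, q + l = N → ∀ σ, HoldsIterate d n ε c r q σ →
      Runs (mainLoop d) σ (l * ((T + 6) * (n + 1)) + 6) (HoldsIterate d n ε c r N) := by
    intro l
    induction l with
    | zero =>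
      intro q hq σ h
      obtain rfl : q = N := hq
      refine ⟨_, σ, .loopFalse fun hb => lt_irrefl _ ((htest h).1 hb), ?_, h⟩
      simp [Test.cost, RealExpr.cost]
    | succ l ih =>
      intro q hq σ h
      obtain ⟨t, τ, he, ht, hQ⟩ := hT h
      obtain ⟨t', τ', he', ht', hQ'⟩ := ih (q + 1) (by omega) τ hQ
      refine ⟨_, τ', .loopTrue ((htest h).2 (by omega)) he he', ?_, hQ'⟩
      simp only [Test.cost, RealExpr.cost]
      nlinarith
  exact (key N 0 (Nat.zero_add N) σ h).mono (by nlinarith) fun _ h => h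

/-- Write one output point, up to coordinate `m`. -/
def outputBody (d : ℕ) : ℕ → Prog
  | 0 => .skip
  | m + 1 => .seq (outputBody d m) (.writeReal 4 (.plus (mulConst d idx) (.const m))
      (.div (coord 11 idxSucc m) (.var 3)))

theorem loopFree_outputBody (d m : ℕ) : (outputBody d m).LoopFree := by
  induction m with
  | zero => trivial
  | succ m ih => exact ⟨ih, trivial⟩

/-- The third clause protects the points already written, whose cells lie below d times the loop
index. -/
theorem run_outputBody (d m : ℕ) (σ : Store) :
    ((outputBody d m).run σ).natVar = σ.natVar ∧ Agree {4} σ ((outputBody d m).run σ) ∧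
    (∀ a < d * σ.natVar 1, ((outputBody d m).run σ).realArr 4 a = σ.realArr 4 a) ∧
    ∀ j < m, ((outputBody d m).run σ).realArr 4 (d * σ.natVar 1 + j)
      = σ.realArr (16 * j + 11) (σ.natVar 1 + 1) / σ.realVar 3 := by
  induction m with
  | zero => exact ⟨rfl, Agree.refl _ _, fun _ _ => rfl, fun j hj => absurd hj (Nat.not_lt_zero _)⟩
  | succ m ih =>
    obtain ⟨h1, h2, h3, h4⟩ := ih
    rw [outputBody, run_seq, run_writeReal]
    set τ := (outputBody d m).run σ
    have hi : (NatExpr.plus (mulConst d idx) (.const m)).eval τ = d * σ.natVar 1 + m := by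
      simp [NatExpr.eval, h1]
    have he : (RealExpr.div (coord 11 idxSucc m) (.var 3)).eval τ
        = σ.realArr (16 * m + 11) (σ.natVar 1 + 1) / σ.realVar 3 := by
      simp only [RealExpr.eval, coord, eval_idxSucc, h1, h2.realVar_three]
      rw [h2.realArr _ (by simp)]
    rw [hi, he]
    refine ⟨h1, h2.sstore (by simp) (by norm_num) _ _, fun a ha => ?_, fun j hj => ?_⟩
    · rw [realArr_sstore_self, Function.update_of_ne (by omega), h3 a ha]
    · rw [realArr_sstore_self]
      rcases Nat.lt_succ_iff_lt_or_eq.1 hj with hj | rfl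
      · rw [Function.update_of_ne (by omega), h4 j hj]
      · rw [Function.update_self]

theorem runs_output (d : ℕ) (σ : Store) :
    Runs (forUp (sizePlus 0) (outputBody d d)) σ
      ((σ.natVar 0 + 1) * ((sizePlus 0).cost + (outputBody d d).time + 7)) fun τ =>
        outputPoints d (σ.natVar 0) τ
          = fun i : Fin (σ.natVar 0) => (σ.realVar 3)⁻¹ • vec d σ 11 (i + 1) := by
  refine (runs_forUp (loopFree_outputBody d d) (m := σ.natVar 0) (I := fun k τ =>
    Agree {4} σ τ ∧ ∀ i < k, ∀ j < d, τ.realArr 4 (d * i + j)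
      = σ.realArr (16 * j + 11) (i + 1) / σ.realVar 3)
    ?_ ?_ ?_ ?_ ?_).mono le_rfl ?_
  · rintro k τ ⟨h, -⟩
    rw [eval_sizePlus, h.natVar, add_zero]
  · rintro k hk τ ⟨h, h'⟩ hidx
    obtain ⟨-, g, g1, g2⟩ := run_outputBody d d τ
    rw [hidx] at g1 g2
    refine ⟨h.trans g, fun i hi j hj => ?_⟩
    rcases Nat.lt_succ_iff_lt_or_eq.1 hi with hi | rfl
    · rw [g1 _ (by nlinarith), h' i hi j hj]
    · rw [g2 j hj, h.realVar_three, h.realArr _ (by simp)]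
  · exact fun τ => (run_outputBody d d τ).1
  · rintro k τ v ⟨h, h'⟩
    exact ⟨h.setIndex v, h'⟩
  · exact ⟨Agree.refl _ _, fun i hi => absurd hi (Nat.not_lt_zero _)⟩
  · rintro τ ⟨-, h⟩
    funext i
    ext j
    change τ.realArr 4 (i * d + j) = (σ.realVar 3)⁻¹ * σ.realArr (16 * j + 11) (i + 1)
    rw [mul_comm (i : ℕ), h i i.2 j j.2, div_eq_inv_mul]

/-- The algorithm for touring disjoint balls. -/
def touringProg (d : ℕ) : Prog :=
  .seq (setupProg d) (.seq (mainLoop d) (forUp (sizePlus 0) (outputBody d d)))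

/-- The number of steps is linear in the number of balls and in `1 / ε`. -/
theorem runs_touringProg (d : ℕ) : ∃ T : ℕ, ∀ {n : ℕ} {ε : ℝ} {start finish : Space d}
    {c : Fin n → Space d} {r : Fin n → ℝ} {σ : Store}, 0 < ε → (∀ i, 0 < r i) →
    DisjointRegions start finish (fun i => Metric.closedBall (c i) (r i)) →
    HoldsInput σ ε start finish c r →
    Runs (touringProg d) σ ((⌈touringConst d / ε⌉₊ + 1) * (T * (n + 1))) fun τ =>
      IsApproxTour ε start finish (fun i => Metric.closedBall (c i) (r i))
        (outputPoints d n τ) := by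
  obtain ⟨T₁, h₁⟩ := runs_setupProg d
  obtain ⟨T₂, h₂⟩ := runs_mainLoop d
  refine ⟨T₁ + T₂ + ((sizePlus 0).cost + (outputBody d d).time + 7), ?_⟩
  intro n ε start finish c r σ hε hr hdisj hin
  set N := ⌈touringConst d / ε⌉₊ with hN
  have hC : (0 : ℝ) < touringConst d := Nat.cast_pos.2 (touringConst_pos d)
  have hNpos : 0 < N := Nat.ceil_pos.2 (div_pos hC hε)
  have hNε : (touringConst d : ℝ) ≤ N * ε := (div_le_iff₀ hε).1 (Nat.le_ceil _)
  refine ((h₁ hin).seq (T' := (N + 1) * (T₂ * (n + 1))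
    + (n + 1) * ((sizePlus 0).cost + (outputBody d d).time + 7)) fun σ₁ hσ₁ =>
    (h₂ hε hσ₁).seq fun σ₂ hσ₂ => ?_).mono ?_ fun _ h => h
  · have hout := runs_output d σ₂
    rw [hσ₂.size] at hout
    refine hout.mono le_rfl fun τ hτ => ?_
    have hmean := isApproxTour_average hr hdisj hNpos hε.le hNε
    rw [hτ]
    convert hmean using 2 with i
    rw [hσ₂.count, hσ₂.sums _ (by omega)]
  · have key : ∀ a : ℕ, T₁ * (n + 1) + ((N + 1) * (T₂ * (n + 1)) + (n + 1) * a)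
        ≤ (N + 1) * ((T₁ + T₂ + a) * (n + 1)) := fun a => by
      have : (N + 1) * ((T₁ + T₂ + a) * (n + 1))
          = T₁ * (n + 1) + ((N + 1) * (T₂ * (n + 1)) + (n + 1) * a)
            + N * ((T₁ + a) * (n + 1)) := by ring
      omega
    exact key _

end RealRAM

end Touring

/-! ### Comparison with the stated running time -/

theorem mainTheorem2 (d : ℕ) (hd : 2 ≤ d) :
    ∃ P : RealRAM.Prog, ∀ ε₀ : ℝ, 0 < ε₀ → ε₀ < 1 → ∃ C : ℝ,
      ∀ (n : ℕ) (ε : ℝ) (start finish : Space d) (c : Fin n → Space d) (r : Fin n → ℝ)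
        (σ : RealRAM.Store),
        0 < ε → ε ≤ ε₀ → (∀ i, 0 < r i) →
        DisjointRegions start finish (fun i => Metric.closedBall (c i) (r i)) →
        RealRAM.HoldsInput σ ε start finish c r →
        ∃ (t : ℕ) (τ : RealRAM.Store),
          RealRAM.Exec P σ t τ ∧
          (t : ℝ) ≤ C * (n / ε ^ (d - 1) * Real.log (1 / ε) ^ 2 + 1 / ε ^ (2 * d - 2)) ∧
          IsApproxTour ε start finish (fun i => Metric.closedBall (c i) (r i))
            (RealRAM.outputPoints d n τ) := by
  obtain ⟨T, hT⟩ := RealRAM.runs_touringProg d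
  refine ⟨RealRAM.touringProg d, fun ε₀ hε₀ hε₁ => ?_⟩
  set K : ℝ := (touringConst d + 2) * T with hK
  have hK0 : 0 ≤ K := by positivity
  set L := Real.log (1 / ε₀) with hL
  have hL0 : 0 < L := Real.log_pos (by rw [lt_div_iff₀ hε₀]; linarith)
  -- The logarithmic factor is at least L ^ 2 > 0 because ε ≤ ε₀ < 1; dividing by L ^ 2 pays for the
  -- term n / ε, and the second K pays for 1 / ε.
  refine ⟨K / L ^ 2 + K, ?_⟩
  intro n ε start finish c r σ hε hεε hr hdisj hin
  obtain ⟨t, τ, hexec, ht, happrox⟩ := hT hε hr hdisj hin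
  refine ⟨t, τ, hexec, ?_, happrox⟩
  have hε1 : ε < 1 := hεε.trans_lt hε₁
  have hceil : (⌈touringConst d / ε⌉₊ + 1 : ℝ) ≤ (touringConst d + 2) / ε := by
    have h1 := Nat.ceil_lt_add_one (a := (touringConst d / ε : ℝ)) (by positivity)
    have h2 : 1 ≤ 1 / ε := (one_le_div hε).2 hε1.le
    rw [add_div, (by ring : 2 / ε = 1 / ε + 1 / ε)]
    linarith
  have ht' : (t : ℝ) ≤ K * ((n + 1) / ε) := by
    have h1 : (t : ℝ) ≤ (⌈touringConst d / ε⌉₊ + 1) * (T * (n + 1)) := by exact_mod_cast ht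
    calc (t : ℝ) ≤ (⌈touringConst d / ε⌉₊ + 1) * (T * (n + 1)) := h1
      _ ≤ (touringConst d + 2) / ε * (T * (n + 1)) := by gcongr
      _ = K * ((n + 1) / ε) := by rw [hK]; ring
  have hlog : L ≤ Real.log (1 / ε) :=
    Real.log_le_log (by positivity) (one_div_le_one_div_of_le hε hεε)
  -- Applied to k = d - 1 and k = 2d - 2, which are at least 1 because d ≥ 2.
  have hpow : ∀ k, 1 ≤ k → 1 / ε ≤ 1 / ε ^ k := fun k hk =>
    one_div_le_one_div_of_le (by positivity) (pow_le_of_le_one hε.le hε1.le (by omega))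
  have h1 : K * (n / ε) ≤ K / L ^ 2 * (n / ε ^ (d - 1) * Real.log (1 / ε) ^ 2) := by
    calc K * (n / ε) = K / L ^ 2 * (n * (1 / ε) * L ^ 2) := by field_simp
      _ ≤ K / L ^ 2 * (n * (1 / ε ^ (d - 1)) * Real.log (1 / ε) ^ 2) := by
        have := hpow (d - 1) (by omega)
        gcongr
      _ = _ := by ring
  have h2 : K * (1 / ε) ≤ K * (1 / ε ^ (2 * d - 2)) := by
    have := hpow (2 * d - 2) (by omega)
    gcongr
  have h3 : 0 ≤ K / L ^ 2 * (1 / ε ^ (2 * d - 2)) := by positivity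
  have h4 : 0 ≤ K * (n / ε ^ (d - 1) * Real.log (1 / ε) ^ 2) := by positivity
  calc (t : ℝ) ≤ K * ((n + 1) / ε) := ht'
    _ = K * (n / ε) + K * (1 / ε) := by ring
    _ ≤ _ := by linarith
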